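/- Fix an integer $d\ge 1$. For an integer $n\ge 1$ let $\mathbb T^d_n=(\mathbb R/n^{1/d}\mathbb Z)^d$ be the flat $d$-dimensional torus of volume $n$, with the metric inherited from the Euclidean metric of $\mathbb R^d$. Let $v_0,\dots,v_{n-1}$ be embedded one after another at independent, uniformly distributed positions in $\mathbb T^d_n$. The $d$-NN tree $G_n$ is the graph on $\{v_0,\dots,v_{n-1}\}$ in which, for every $i\in\{1,\dots,n-1\}$, the vertex $v_i$ is connected by an edge to the vertex closest to it (in the torus metric) among $v_0,\dots,v_{i-1}$, ties being broken arbitrarily; there are no other edges. Let $\Delta(G_n)$ denote the maximum degree of $G_n$. Theorem. $\Delta(G_n)=\Theta_d(\log n)$ with probability at least $1-n^{-\omega(1)}$. That is, there are constants $c=c(d)>0$ and $C=C(d)>0$ and a function $f=f_d:\mathbb N\to\mathbb R$ with $f(n)\to\infty$ as $n\to\infty$ such that, for every $n\ge 1$, $$\mathbb P\bigl(c\log n\le \Delta(G_n)\le C\log n\bigr)\ge 1-n^{-f(n)}.$$ -/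

import Mathlib

open MeasureTheory ProbabilityTheory Filter

/-- The side length `n ^ (1 / d)` of the flat `d`-dimensional torus of volume `n`. -/
noncomputable def torusSide (d n : ℕ) : ℝ := (n : ℝ) ^ (1 / (d : ℝ))

instance torusSide_pos (d n : ℕ) [NeZero n] : Fact (0 < torusSide d n) :=
  ⟨Real.rpow_pos_of_pos (Nat.cast_pos.mpr (Nat.pos_of_ne_zero (NeZero.ne n))) _⟩

/-- The flat torus of dimension `d` and volume `n`, that is `(ℝ / n ^ (1 / d) ℤ) ^ d`. Only the
set, the product σ-algebra and the product (Haar–Lebesgue) measure of this type are used; the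
metric is `torusDist`. -/
abbrev FlatTorus (d n : ℕ) : Type := Fin d → AddCircle (torusSide d n)

/-- The metric on the flat torus inherited from the Euclidean metric of `ℝ ^ d`. The norm of an
element of `AddCircle L` is the distance of any of its representatives to `L ℤ`. -/
noncomputable def torusDist {d n : ℕ} (x y : FlatTorus d n) : ℝ :=
  Real.sqrt (∑ k, ‖x k - y k‖ ^ 2)

/-- The uniform distribution on the flat torus of volume `n`. -/
noncomputable def torusUniform (d n : ℕ) [NeZero n] : Measure (FlatTorus d n) :=
  (n : ENNReal)⁻¹ • volume

/-- `G` is an online nearest neighbor tree on the vertices `0, …, n - 1`, embedded in this order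
at the positions `x`: its edges are the pairs `{i, p i}` with `i > 0`, where `p i` is a closest
one among the vertices before `i`. Ties are broken arbitrarily. -/
def IsNNTree {d n : ℕ} (x : Fin n → FlatTorus d n) (G : SimpleGraph (Fin n)) : Prop :=
  ∃ p : Fin n → Fin n,
    (∀ i : Fin n, 0 < (i : ℕ) →
      p i < i ∧ ∀ j : Fin n, j < i → torusDist (x i) (x (p i)) ≤ torusDist (x i) (x j)) ∧
    ∀ i j : Fin n, G.Adj i j ↔ (0 < (i : ℕ) ∧ p i = j) ∨ (0 < (j : ℕ) ∧ p j = i)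

/-- On the probability space `(Ω, P)`, the random graph `G` is a `d`-NN tree on `n` vertices whose
positions `x` are independent and uniformly distributed on the flat torus of volume `n`. -/
structure IsRandomNNTree {d n : ℕ} [NeZero n] {Ω : Type*} [MeasurableSpace Ω] (P : Measure Ω)
    (x : Fin n → Ω → FlatTorus d n) (G : Ω → SimpleGraph (Fin n)) : Prop where
  indep : iIndepFun x P
  law : ∀ i, HasLaw (x i) (torusUniform d n) P
  tree : ∀ ω, IsNNTree (fun i => x i ω) (G ω)

open Classical in
/-- The maximum degree of a graph on a finite vertex set. -/
noncomputable def graphMaxDegree {V : Type*} [Fintype V] (G : SimpleGraph V) : ℕ := G.maxDegree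

/-! Both bounds rest on deterministic geometry combined with one probabilistic estimate each. On
`FlatTorus`, `dist` is the sup metric, within a factor `d` of `torusDist`; balls are taken in `dist`
because their volumes are explicit products.

Upper bound. If `w < w'` are both children of `v`, then `w'` is at least as close to `v` as to `w`.
Children of `v` at distance between `s` and `2 * s` are therefore `s`-separated, and packing leaves
boundedly many of them (`card_le_of_le_torusDist`). There are `O(log n)` dyadic scales above `1 /
n`, and a union bound over a fine grid shows that no ball of radius `1 / n` about a vertex holds
more than about `log n` vertices, except with probability `exp(-Ω(log² n))`
(`measureReal_exists_crowded_le`).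

Lower bound. Time is cut into `K` blocks, of order `log n` in number, whose ends grow by the factor
`(4 * d + 4) ^ d`, while radii `ρ k` about a centre shrink by `4 * d + 4`; block `k` thus puts
boundedly many points on average at scale `ρ k`. Suppose block 0 has a single point near the centre,
extremely close to it, and every later block has a single point near its scale, in a shell that
keeps it away from the smaller scales. Then each of these later points attaches to the point of
block 0 (`le_graphMaxDegree_add_one`). This pattern has probability at least `Q ^ (-2 * K)` with `Q`
depending on `d` only (`le_measureReal_shellPattern`), and a grid supplies at least `n / Q ^ (2 *
K)` disjoint places for it. Moving one point changes the number of successful places by at most 2,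
so McDiarmid's inequality makes total failure exponentially unlikely in `√n`
(`measureReal_graphMaxDegree_small_le`). -/

/-! ### McDiarmid's inequality. -/

theorem integrable_of_measurable_of_abs_le {X : Type*} [MeasurableSpace X] {μ : Measure X}
    [IsFiniteMeasure μ] {f : X → ℝ} (hf : Measurable f) {B : ℝ} (hB : ∀ x, |f x| ≤ B) :
    Integrable f μ :=
  Integrable.of_bound hf.aestronglyMeasurable B (ae_of_all _ hB)

theorem integrable_exp_of_abs_le {X : Type*} [MeasurableSpace X] {μ : Measure X}
    [IsFiniteMeasure μ] {f : X → ℝ} (hf : Measurable f) {B : ℝ} (hB : ∀ x, |f x| ≤ B) :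
    Integrable (fun x => Real.exp (f x)) μ :=
  integrable_of_measurable_of_abs_le (B := Real.exp B) (Real.measurable_exp.comp hf) fun x => by
    rw [abs_of_pos (Real.exp_pos _)]
    exact Real.exp_le_exp.mpr ((le_abs_self _).trans (hB x))

/-- Hoeffding's lemma on an interval of length `2 * c` centred at one value of `F`. This avoids the
infimum and supremum of `F` and costs only a constant in the exponent. -/
theorem integral_exp_mul_sub_integral_le {X : Type*} [MeasurableSpace X] (μ : Measure X)
    [IsProbabilityMeasure μ] {c : ℝ} {F : X → ℝ} (hF : Measurable F)
    (hc : ∀ x y, |F x - F y| ≤ c) (t : ℝ) :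
    ∫ x, Real.exp (t * (F x - ∫ y, F y ∂μ)) ∂μ ≤ Real.exp (c ^ 2 * t ^ 2 / 2) := by
  obtain ⟨x₀⟩ : Nonempty X := μ.nonempty_of_neZero
  have h := hasSubgaussianMGF_of_mem_Icc (μ := μ) (a := F x₀ - c) (b := F x₀ + c)
    hF.aemeasurable (ae_of_all _ fun x => by
      have := abs_le.mp (hc x x₀)
      constructor <;> linarith)
  have h2 := h.mgf_le t
  have e : (((‖(F x₀ + c) - (F x₀ - c)‖₊ / 2) ^ 2 : NNReal) : ℝ) = c ^ 2 := by
    push_cast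
    rw [Real.norm_eq_abs, div_pow, sq_abs]
    ring
  rw [e] at h2
  exact h2

/-- **McDiarmid's inequality**, at the level of exponential moments. -/
theorem integral_exp_sub_integral_le_of_bounded_differences {X : Type*} [MeasurableSpace X]
    (μ : Measure X) [IsProbabilityMeasure μ] {c : ℝ} (t : ℝ) :
    ∀ (n : ℕ) (f : (Fin n → X) → ℝ), Measurable f → ∀ B : ℝ, (∀ x, |f x| ≤ B) →
      (∀ x y : Fin n → X, ∀ i, (∀ j, j ≠ i → x j = y j) → |f x - f y| ≤ c) →
      ∫ x, Real.exp (t * (f x - ∫ y, f y ∂Measure.pi fun _ => μ)) ∂Measure.pi (fun _ => μ)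
        ≤ Real.exp (n * (c ^ 2 * t ^ 2 / 2)) := by
  intro n
  induction n with
  | zero =>
    intro f hf B hB hd
    have : ∀ x, f x = f default := fun x => by rw [Subsingleton.elim x default]
    simp [this]
  | succ n ih =>
    intro f hf B hB hd
    let e := MeasurableEquiv.piFinSuccAbove (fun _ : Fin (n + 1) => X) 0
    have he := (measurePreserving_piFinSuccAbove (fun _ : Fin (n + 1) => μ) 0).symm
    have hes : ∀ p : X × (Fin n → X), e.symm p = Fin.cons p.1 p.2 := fun p => by
      simp [e, MeasurableEquiv.piFinSuccAbove, Fin.insertNthEquiv]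
    have hI : ∀ g : (Fin (n + 1) → X) → ℝ,
        ∫ x, g x ∂Measure.pi (fun _ => μ)
          = ∫ p, g (Fin.cons p.1 p.2) ∂(μ.prod (Measure.pi fun _ => μ)) := fun g => by
      rw [← he.integral_comp']
      exact integral_congr_ae (ae_of_all _ fun p => congrArg g (hes p))
    have hm : Measurable fun p : X × (Fin n → X) => f (Fin.cons p.1 p.2) := by
      have h : (fun p : X × (Fin n → X) => f (Fin.cons p.1 p.2)) = f ∘ e.symm := by
        funext p; exact congrArg f (hes p).symm
      rw [h]
      exact hf.comp e.symm.measurable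
    -- `F` is the conditional expectation given the first coordinate. The deviation of `f` splits
    -- into `f - F`, handled by induction for each fixed first coordinate, and `F` minus its mean, a
    -- function of one variable that inherits the difference bound `c`.
    let F : X → ℝ := fun a => ∫ y, f (Fin.cons a y) ∂Measure.pi fun _ : Fin n => μ
    have hma : ∀ a, Measurable fun y : Fin n → X => f (Fin.cons a y) := fun a =>
      hm.comp (measurable_const.prodMk measurable_id)
    have hia : ∀ a, Integrable (fun y : Fin n → X => f (Fin.cons a y)) (Measure.pi fun _ => μ) :=
      fun a => integrable_of_measurable_of_abs_le (hma a) fun y => hB _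
    have hFm : Measurable F :=
      (hm.stronglyMeasurable.integral_prod_right (ν := Measure.pi fun _ : Fin n => μ)).measurable
    have hFB : ∀ a, |F a| ≤ B := fun a => by
      have := norm_integral_le_of_norm_le_const (μ := Measure.pi fun _ : Fin n => μ) (C := B)
        (f := fun y => f (Fin.cons a y)) (ae_of_all _ fun y => hB (Fin.cons a y))
      simpa using this
    have hFd : ∀ a b, |F a - F b| ≤ c := fun a b => by
      have h1 : F a - F b = ∫ y, (f (Fin.cons a y) - f (Fin.cons b y)) ∂Measure.pi
          fun _ : Fin n => μ := (integral_sub (hia a) (hia b)).symm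
      rw [h1]
      have := norm_integral_le_of_norm_le_const (μ := Measure.pi fun _ : Fin n => μ) (C := c)
        (f := fun y => f (Fin.cons a y) - f (Fin.cons b y))
        (ae_of_all _ fun y => hd _ _ 0 fun j hj => by
          obtain ⟨k, rfl⟩ := Fin.exists_succ_eq.mpr hj
          simp)
      simpa using this
    have hmean : ∫ y, f y ∂Measure.pi (fun _ => μ) = ∫ a, F a ∂μ := by
      rw [hI, integral_prod]
      exact integrable_of_measurable_of_abs_le hm fun p => hB _
    have habs : ∀ u v : ℝ, |u| ≤ B → |v| ≤ B → |t * (u - v)| ≤ |t| * (B + B) := fun u v hu hv => by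
      rw [abs_mul]
      exact mul_le_mul_of_nonneg_left ((abs_sub _ _).trans (add_le_add hu hv)) (abs_nonneg t)
    have hmB : |∫ a, F a ∂μ| ≤ B := by
      have := norm_integral_le_of_norm_le_const (μ := μ) (C := B) (f := F) (ae_of_all _ fun y => hFB y)
      simpa using this
    rw [hmean, hI, integral_prod]
    swap
    · exact integrable_exp_of_abs_le ((hm.sub_const _).const_mul t) fun p => habs _ _ (hB _) hmB
    calc ∫ a, ∫ y, Real.exp (t * (f (Fin.cons a y) - ∫ a, F a ∂μ)) ∂Measure.pi (fun _ => μ) ∂μ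
        = ∫ a, Real.exp (t * (F a - ∫ a, F a ∂μ)) *
            ∫ y, Real.exp (t * (f (Fin.cons a y) - F a)) ∂Measure.pi (fun _ => μ) ∂μ := by
          refine integral_congr_ae (ae_of_all _ fun a => ?_)
          simp only
          rw [← integral_const_mul]
          refine integral_congr_ae (ae_of_all _ fun y => ?_)
          simp only
          rw [← Real.exp_add]
          ring_nf
      _ ≤ ∫ a, Real.exp (t * (F a - ∫ a, F a ∂μ)) * Real.exp (n * (c ^ 2 * t ^ 2 / 2)) ∂μ := by
          refine integral_mono_of_nonneg (ae_of_all _ fun a => ?_) ?_ (ae_of_all _ fun a => ?_)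
          · exact mul_nonneg (Real.exp_pos _).le (integral_nonneg fun _ => (Real.exp_pos _).le)
          · exact (integrable_exp_of_abs_le ((hFm.sub_const _).const_mul t)
              fun p => habs _ _ (hFB _) hmB).mul_const _
          · refine mul_le_mul_of_nonneg_left ?_ (Real.exp_pos _).le
            refine ih (fun y => f (Fin.cons a y)) (hma a) B (fun _ => hB _) ?_
            intro x y i hxy
            refine hd _ _ i.succ fun j hj => ?_
            induction j using Fin.cases with
            | zero => simp
            | succ k => simpa using hxy k fun h => hj (by rw [h])
      _ = (∫ a, Real.exp (t * (F a - ∫ a, F a ∂μ)) ∂μ) * Real.exp (n * (c ^ 2 * t ^ 2 / 2)) :=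
          integral_mul_const _ _
      _ ≤ Real.exp (c ^ 2 * t ^ 2 / 2) * Real.exp (n * (c ^ 2 * t ^ 2 / 2)) :=
          mul_le_mul_of_nonneg_right (integral_exp_mul_sub_integral_le μ hFm hFd t)
            (Real.exp_pos _).le
      _ = Real.exp ((n + 1 : ℕ) * (c ^ 2 * t ^ 2 / 2)) := by
          rw [← Real.exp_add]; push_cast; ring_nf

/-- **McDiarmid's inequality** for the event that a function vanishes. -/
theorem measure_eq_zero_le_of_bounded_differences {X : Type*} [MeasurableSpace X]
    (μ : Measure X) [IsProbabilityMeasure μ] {n : ℕ} (hn : 0 < n) {c : ℝ} (hc : 0 < c)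
    {f : (Fin n → X) → ℝ} (hf : Measurable f) {B : ℝ} (hB : ∀ x, |f x| ≤ B)
    (hd : ∀ x y : Fin n → X, ∀ i, (∀ j, j ≠ i → x j = y j) → |f x - f y| ≤ c)
    {m : ℝ} (hm0 : 0 ≤ m) (hm : m ≤ ∫ x, f x ∂Measure.pi fun _ => μ) :
    (Measure.pi fun _ : Fin n => μ).real {x | f x = 0}
      ≤ Real.exp (-(m ^ 2 / (2 * n * c ^ 2))) := by
  set I := ∫ x, f x ∂Measure.pi fun _ : Fin n => μ
  have hnc : (0 : ℝ) < n * c ^ 2 := by positivity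
  -- The minimiser of the Chernoff exponent `n * c ^ 2 * t ^ 2 / 2 + t * I`.
  set t : ℝ := -(I / (n * c ^ 2)) with ht
  have h1 := integral_exp_sub_integral_le_of_bounded_differences μ t n f hf B hB hd
  have hint : Integrable (fun x => Real.exp (t * (f x - I))) (Measure.pi fun _ : Fin n => μ) := by
    refine integrable_exp_of_abs_le (B := |t| * (B + |I|)) ((hf.sub_const _).const_mul t) fun x => ?_
    rw [abs_mul]
    exact mul_le_mul_of_nonneg_left ((abs_sub _ _).trans (add_le_add_left (hB x) _)) (abs_nonneg t)
  have h2 := mul_meas_ge_le_integral_of_nonneg (μ := Measure.pi fun _ : Fin n => μ)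
    (ae_of_all _ fun x => (Real.exp_pos (t * (f x - I))).le) hint (Real.exp (t * (0 - I)))
  have h3 : (Measure.pi fun _ : Fin n => μ).real {x | f x = 0}
      ≤ (Measure.pi fun _ : Fin n => μ).real
        {x | Real.exp (t * (0 - I)) ≤ Real.exp (t * (f x - I))} :=
    measureReal_mono fun x hx => by
      have : f x = 0 := hx
      simp [this]
  have h4 : Real.exp (t * (0 - I)) * (Measure.pi fun _ : Fin n => μ).real {x | f x = 0}
      ≤ Real.exp (n * (c ^ 2 * t ^ 2 / 2)) :=
    (mul_le_mul_of_nonneg_left h3 (Real.exp_pos _).le).trans (h2.trans h1)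
  have h5 : (Measure.pi fun _ : Fin n => μ).real {x | f x = 0}
      ≤ Real.exp (n * (c ^ 2 * t ^ 2 / 2) - t * (0 - I)) := by
    rw [Real.exp_sub, le_div_iff₀ (Real.exp_pos _), mul_comm]
    exact h4
  refine h5.trans (Real.exp_le_exp.mpr ?_)
  have e : n * (c ^ 2 * t ^ 2 / 2) - t * (0 - I) = -(I ^ 2 / (2 * n * c ^ 2)) := by
    rw [ht]; field_simp; ring
  rw [e]
  gcongr

/-! ### Labelled patterns: probability and concentration. -/

/-- The configurations for which, for every `k < K`, exactly one point with label `k` lies in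
`B k`, and this point lies in `A k`. -/
def labelledPattern {X : Type*} {n : ℕ} (b : Fin n → ℕ) (K : ℕ) (A B : ℕ → Set X) :
    Set (Fin n → X) :=
  {x | ∀ k < K, ∃ i, b i = k ∧ x i ∈ A k ∧ ∀ j, b j = k → j ≠ i → x j ∉ B k}

theorem measurableSet_labelledPattern {X : Type*} [MeasurableSpace X] {n : ℕ} (b : Fin n → ℕ)
    (K : ℕ) {A B : ℕ → Set X} (hA : ∀ k, MeasurableSet (A k)) (hB : ∀ k, MeasurableSet (B k)) :
    MeasurableSet (labelledPattern b K A B) := by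
  have h : labelledPattern b K A B = ⋂ k, ⋂ (_ : k < K), ⋃ i, ⋃ (_ : b i = k),
      ((fun x : Fin n → X => x i) ⁻¹' A k ∩
        ⋂ j, ⋂ (_ : b j = k), ⋂ (_ : j ≠ i), ((fun x : Fin n → X => x j) ⁻¹' B k)ᶜ) := by
    ext x
    simp [labelledPattern, and_left_comm]
  rw [h]
  refine MeasurableSet.iInter fun k => MeasurableSet.iInter fun _ => MeasurableSet.iUnion fun i =>
    MeasurableSet.iUnion fun _ => (measurable_pi_apply i (hA k)).inter ?_
  exact MeasurableSet.iInter fun j => MeasurableSet.iInter fun _ => MeasurableSet.iInter fun _ =>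
    (measurable_pi_apply j (hB k)).compl

/-- Choosing which index plays the special role for each label turns the pattern into a product box.
Different choices give disjoint boxes, so their measures add up; the number of choices is the
product of the block sizes. -/
theorem prod_le_measureReal_labelledPattern {X : Type*} [MeasurableSpace X] (μ : Measure X)
    [IsProbabilityMeasure μ] {n : ℕ} (b : Fin n → ℕ) (K : ℕ) {A B : ℕ → Set X}
    (hA : ∀ k, MeasurableSet (A k)) (hB : ∀ k, MeasurableSet (B k)) (hAB : ∀ k < K, A k ⊆ B k)
    {a q : ℕ → ℝ} (ha0 : ∀ k < K, 0 ≤ a k) (hq0 : ∀ k < K, 0 ≤ q k)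
    (ha : ∀ k < K, a k ≤ μ.real (A k)) (hq : ∀ k < K, q k ≤ μ.real (B k)ᶜ) :
    ∏ k : Fin K, ((Finset.univ.filter fun i => b i = k).card *
        (a k * q k ^ (Finset.univ.filter fun i => b i = k).card))
      ≤ (Measure.pi fun _ : Fin n => μ).real (labelledPattern b K A B) := by
  classical
  let S : (Fin K → Fin n) → Fin n → Set X := fun c j =>
    if h : b j < K then (if c ⟨b j, h⟩ = j then A (b j) else (B (b j))ᶜ) else Set.univ
  have hSm : ∀ c j, MeasurableSet (S c j) := fun c j => by
    simp only [S]
    split_ifs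
    exacts [hA _, (hB _).compl, MeasurableSet.univ]
  let T : Finset (Fin K → Fin n) :=
    Fintype.piFinset fun k : Fin K => Finset.univ.filter fun i => b i = k
  have hT : ∀ c ∈ T, ∀ k, b (c k) = k := fun c hc k => by
    simpa using Fintype.mem_piFinset.mp hc k
  have hq1 : ∀ k < K, q k ≤ 1 := fun k hk => (hq k hk).trans measureReal_le_one
  have hpoint : ∀ c ∈ T, ∀ j, ∏ k : Fin K, ((if c k = j then a k else 1) *
      (if b j = k then q k else 1)) ≤ μ.real (S c j) := by
    intro c hc j
    by_cases h : b j < K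
    · rw [Finset.prod_eq_single ⟨b j, h⟩]
      · by_cases h' : c ⟨b j, h⟩ = j
        · have : S c j = A (b j) := by simp [S, h, h']
          rw [this]
          simp only [h', if_true]
          -- The special index is charged a superfluous factor `q`, so that the exponent is the full
          -- block size.
          exact (mul_le_of_le_one_right (ha0 _ h) (hq1 _ h)).trans (ha _ h)
        · have : S c j = (B (b j))ᶜ := by simp [S, h, h']
          rw [this]
          simp only [h', if_true, if_false, one_mul]
          exact hq _ h
      · intro k _ hk
        have h1 : b j ≠ k := fun e => hk (Fin.ext e.symm)
        have h2 : c k ≠ j := fun e => h1 (by rw [← e]; exact hT c hc k)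
        simp [h1, h2]
      · simp
    · rw [Finset.prod_eq_one]
      · simp [S, h]
      · intro k _
        have h1 : b j ≠ k := fun e => h (e ▸ k.2)
        have h2 : c k ≠ j := fun e => h1 (by rw [← e]; exact hT c hc k)
        simp [h1, h2]
  have hmeas : ∀ c ∈ T, ∏ k : Fin K, (a k * q k ^ (Finset.univ.filter fun i => b i = k).card)
      ≤ (Measure.pi fun _ : Fin n => μ).real (Set.univ.pi (S c)) := by
    intro c hc
    rw [measureReal_def, Measure.pi_pi, ENNReal.toReal_prod]
    calc ∏ k : Fin K, (a k * q k ^ (Finset.univ.filter fun i => b i = k).card)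
        = ∏ k : Fin K, ∏ j : Fin n, ((if c k = j then a k else 1) *
            (if b j = k then q k else 1)) := by
          refine Finset.prod_congr rfl fun k _ => ?_
          rw [Finset.prod_mul_distrib, Finset.prod_ite_eq, Finset.prod_ite]
          simp
      _ = ∏ j : Fin n, ∏ k : Fin K, ((if c k = j then a k else 1) *
            (if b j = k then q k else 1)) := Finset.prod_comm
      _ ≤ ∏ j : Fin n, μ.real (S c j) := by
          refine Finset.prod_le_prod (fun j _ => Finset.prod_nonneg fun k _ => ?_)
            fun j _ => hpoint c hc j
          have := ha0 k k.2
          have := hq0 k k.2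
          positivity
  have hdisj : Set.PairwiseDisjoint (T : Set (Fin K → Fin n)) fun c => Set.univ.pi (S c) := by
    intro c hc c' hc' hne
    rw [Function.onFun, Set.disjoint_left]
    intro x hx hx'
    -- At a label where the choices differ, the point chosen by `c` lies in `A k` in the first box
    -- and outside `B k` in the second.
    obtain ⟨k, hk⟩ := Function.ne_iff.mp hne
    have e1 := hT c hc k
    have h1 := hx (c k) trivial
    have h2 := hx' (c k) trivial
    have s1 : S c (c k) = A k := by simp [S, e1]
    have s2 : S c' (c k) = (B k)ᶜ := by simp [S, e1, hk.symm]
    rw [s1] at h1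
    rw [s2] at h2
    exact h2 (hAB k k.2 h1)
  have hsub : (⋃ c ∈ T, Set.univ.pi (S c)) ⊆ labelledPattern b K A B := by
    intro x hx
    obtain ⟨c, hc, hx⟩ := Set.mem_iUnion₂.mp hx
    intro k hk
    have e1 := hT c hc ⟨k, hk⟩
    refine ⟨c ⟨k, hk⟩, e1, ?_, ?_⟩
    · have h1 := hx (c ⟨k, hk⟩) trivial
      simpa [S, e1, hk] using h1
    · intro j hj hji
      have h1 := hx j trivial
      subst hj
      simpa [S, hk, hji.symm] using h1
  calc _ = (T.card : ℝ) * ∏ k : Fin K, (a k * q k ^ (Finset.univ.filter fun i => b i = k).card) := by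
        rw [Finset.prod_mul_distrib, Fintype.card_piFinset]
        push_cast
        rfl
    _ ≤ ∑ c ∈ T, (Measure.pi fun _ : Fin n => μ).real (Set.univ.pi (S c)) := by
        rw [← nsmul_eq_mul]
        exact Finset.card_nsmul_le_sum _ _ _ hmeas
    _ = (Measure.pi fun _ : Fin n => μ).real (⋃ c ∈ T, Set.univ.pi (S c)) :=
        (measureReal_biUnion_finset hdisj fun c _ => MeasurableSet.univ_pi (hSm c)).symm
    _ ≤ _ := measureReal_mono hsub

theorem labelledPattern_of_eq_outside {X : Type*} {n : ℕ} {b : Fin n → ℕ} {K : ℕ}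
    {A B : ℕ → Set X} {U : Set X} (hA : ∀ k < K, A k ⊆ U) (hB : ∀ k < K, B k ⊆ U)
    {x y : Fin n → X} {i : Fin n} (h : ∀ j, j ≠ i → x j = y j) (hx : x i ∉ U) (hy : y i ∉ U)
    (hxp : x ∈ labelledPattern b K A B) : y ∈ labelledPattern b K A B := by
  intro k hk
  obtain ⟨l, hl, hlA, hlB⟩ := hxp k hk
  have hli : l ≠ i := fun e => hx (e ▸ hA k hk hlA)
  refine ⟨l, hl, h l hli ▸ hlA, fun j hj hjl => ?_⟩
  by_cases hji : j = i
  · rw [hji]; exact fun h' => hy (hB k hk h')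
  · rw [← h j hji]; exact hlB j hj hjl

theorem sum_indicator_one_le_one {X ι : Type*} {Z : Finset ι} {U : ι → Set X}
    (hU : Set.PairwiseDisjoint (Z : Set ι) U) (x : X) :
    ∑ z ∈ Z, (U z).indicator (fun _ => (1 : ℝ)) x ≤ 1 := by
  classical
  by_cases h : ∃ z ∈ Z, x ∈ U z
  · obtain ⟨z, hz, hxz⟩ := h
    rw [Finset.sum_eq_single_of_mem z hz]
    · simp [hxz]
    · intro w hw hwz
      exact Set.indicator_of_notMem
        (fun hxw => Set.disjoint_left.mp (hU hw hz hwz) hxw hxz) _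
  · push Not at h
    rw [Finset.sum_eq_zero]
    · exact zero_le_one
    · intro z hz
      exact Set.indicator_of_notMem (h z hz) _

/-- The function fed to McDiarmid is the number of `z` whose pattern occurs. Moving one point
affects only those `z` whose region `U z` contains its old or new position, at most one each by
disjointness; hence differences at most 2 and the constant `8 = 2 * 2 ^ 2`. -/
theorem measure_forall_notMem_labelledPattern_le {X ι : Type*} [MeasurableSpace X] (μ : Measure X)
    [IsProbabilityMeasure μ] {n : ℕ} (hn : 0 < n) (b : Fin n → ℕ) (K : ℕ) (Z : Finset ι)
    {A B : ι → ℕ → Set X} {U : ι → Set X}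
    (hA : ∀ z k, MeasurableSet (A z k)) (hB : ∀ z k, MeasurableSet (B z k))
    (hAU : ∀ z, ∀ k < K, A z k ⊆ U z) (hBU : ∀ z, ∀ k < K, B z k ⊆ U z)
    (hU : Set.PairwiseDisjoint (Z : Set ι) U) {m : ℝ} (hm0 : 0 ≤ m)
    (hm : m ≤ ∑ z ∈ Z, (Measure.pi fun _ : Fin n => μ).real (labelledPattern b K (A z) (B z))) :
    (Measure.pi fun _ : Fin n => μ).real {x | ∀ z ∈ Z, x ∉ labelledPattern b K (A z) (B z)}
      ≤ Real.exp (-(m ^ 2 / (8 * n))) := by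
  have hE := fun z => measurableSet_labelledPattern b K (hA z) (hB z)
  let g : ι → (Fin n → X) → ℝ := fun z =>
    (labelledPattern b K (A z) (B z)).indicator fun _ => (1 : ℝ)
  have hg0 : ∀ z x, 0 ≤ g z x := fun z x => Set.indicator_nonneg (fun _ _ => zero_le_one) x
  have hg1 : ∀ z x, g z x ≤ 1 := fun z x => Set.indicator_le_self' (fun _ _ => zero_le_one) x
  let f : (Fin n → X) → ℝ := fun x => ∑ z ∈ Z, g z x
  have hgm : ∀ z, Measurable (g z) := fun z => measurable_const.indicator (hE z)
  have hf : Measurable f := Finset.measurable_sum _ fun z _ => hgm z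
  have hfB : ∀ x, |f x| ≤ Z.card := fun x => by
    rw [abs_of_nonneg (Finset.sum_nonneg fun z _ => hg0 z x)]
    simpa using Finset.sum_le_sum fun z (_ : z ∈ Z) => hg1 z x
  have hd : ∀ x y : Fin n → X, ∀ i, (∀ j, j ≠ i → x j = y j) → |f x - f y| ≤ 2 := by
    intro x y i h
    calc |f x - f y| = |∑ z ∈ Z, (g z x - g z y)| := by rw [Finset.sum_sub_distrib]
      _ ≤ ∑ z ∈ Z, |g z x - g z y| := Finset.abs_sum_le_sum_abs _ _
      _ ≤ ∑ z ∈ Z, ((U z).indicator (fun _ => (1 : ℝ)) (x i) +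
            (U z).indicator (fun _ => (1 : ℝ)) (y i)) := by
          refine Finset.sum_le_sum fun z _ => ?_
          by_cases hx : x i ∈ U z
          · rw [Set.indicator_of_mem hx]
            have := Set.indicator_nonneg (s := U z) (f := fun _ => (1 : ℝ))
              (fun _ _ => zero_le_one) (y i)
            have := abs_sub_le_of_le_of_le (hg0 z x) (hg1 z x) (hg0 z y) (hg1 z y)
            linarith
          by_cases hy : y i ∈ U z
          · rw [Set.indicator_of_mem hy]
            have := Set.indicator_nonneg (s := U z) (f := fun _ => (1 : ℝ))
              (fun _ _ => zero_le_one) (x i)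
            have := abs_sub_le_of_le_of_le (hg0 z x) (hg1 z x) (hg0 z y) (hg1 z y)
            linarith
          have hiff : x ∈ labelledPattern b K (A z) (B z) ↔ y ∈ labelledPattern b K (A z) (B z) :=
            ⟨labelledPattern_of_eq_outside (hAU z) (hBU z) h hx hy,
              labelledPattern_of_eq_outside (hAU z) (hBU z) (fun j hj => (h j hj).symm) hy hx⟩
          have : g z x = g z y := by
            simp only [g, Set.indicator]
            by_cases hxE : x ∈ labelledPattern b K (A z) (B z)
            · simp [hxE, hiff.mp hxE]
            · rw [if_neg hxE, if_neg (mt hiff.mpr hxE)]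
          simp [this, hx, hy]
      _ ≤ 1 + 1 := by
          rw [Finset.sum_add_distrib]
          exact add_le_add (sum_indicator_one_le_one hU _) (sum_indicator_one_le_one hU _)
      _ = 2 := by norm_num
  have hint : ∫ x, f x ∂(Measure.pi fun _ : Fin n => μ)
      = ∑ z ∈ Z, (Measure.pi fun _ : Fin n => μ).real (labelledPattern b K (A z) (B z)) := by
    rw [integral_finsetSum]
    · exact Finset.sum_congr rfl fun z _ => integral_indicator_one (hE z)
    · exact fun z _ => integrable_of_measurable_of_abs_le (hgm z) (B := 1) fun x => by
        rw [abs_of_nonneg (hg0 z x)]; exact hg1 z x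
  have key := measure_eq_zero_le_of_bounded_differences μ hn two_pos hf hfB hd hm0 (hint ▸ hm)
  have e : 2 * (n : ℝ) * 2 ^ 2 = 8 * n := by ring
  rw [e] at key
  refine (measureReal_mono fun x hx => ?_).trans key
  exact Finset.sum_eq_zero fun z hz => Set.indicator_of_notMem (hx z hz) _

/-! ### Volumes, metrics and grids on the flat torus. -/

theorem torusSide_pow {d n : ℕ} (hd : 1 ≤ d) : torusSide d n ^ d = n := by
  have hd' : (d : ℝ) ≠ 0 := by positivity
  rw [torusSide, ← Real.rpow_natCast, ← Real.rpow_mul (Nat.cast_nonneg n), one_div,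
    inv_mul_cancel₀ hd', Real.rpow_one]

theorem torusSide_pos' (d n : ℕ) [NeZero n] : 0 < torusSide d n := (torusSide_pos d n).out

theorem torusSide_le {d n : ℕ} [NeZero n] (hd : 1 ≤ d) : torusSide d n ≤ n := by
  have hn : (1 : ℝ) ≤ n := by exact_mod_cast NeZero.one_le
  have hd' : (1 : ℝ) ≤ d := by exact_mod_cast hd
  calc (n : ℝ) ^ (1 / (d : ℝ)) ≤ (n : ℝ) ^ (1 : ℝ) :=
        Real.rpow_le_rpow_of_exponent_le hn (by rw [div_le_one (by positivity)]; exact hd')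
    _ = n := Real.rpow_one _

theorem isProbabilityMeasure_torusUniform {d n : ℕ} [NeZero n] (hd : 1 ≤ d) :
    IsProbabilityMeasure (torusUniform d n) := by
  constructor
  have hn : (n : ENNReal) ≠ 0 := by exact_mod_cast NeZero.ne n
  rw [torusUniform, Measure.smul_apply, volume_pi, Measure.pi_univ]
  simp only [AddCircle.measure_univ, Finset.prod_const, Finset.card_univ, Fintype.card_fin]
  rw [← ENNReal.ofReal_pow (torusSide_pos' d n).le, torusSide_pow hd, ENNReal.ofReal_natCast,
    smul_eq_mul, ENNReal.inv_mul_cancel hn (ENNReal.natCast_ne_top n)]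

theorem torusUniform_closedBall {d n : ℕ} [NeZero n] (z : FlatTorus d n) {r : ℝ} (hr : 0 ≤ r) :
    (torusUniform d n).real (Metric.closedBall z r) = min (torusSide d n) (2 * r) ^ d / n := by
  have h0 : 0 ≤ min (torusSide d n) (2 * r) := le_min (torusSide_pos' d n).le (by positivity)
  rw [measureReal_def, torusUniform, Measure.smul_apply, closedBall_pi _ hr, volume_pi,
    Measure.pi_pi]
  simp only [AddCircle.volume_closedBall, Finset.prod_const, Finset.card_univ, Fintype.card_fin]
  rw [smul_eq_mul, ENNReal.toReal_mul, ENNReal.toReal_pow, ENNReal.toReal_ofReal h0,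
    ENNReal.toReal_inv, ENNReal.toReal_natCast]
  ring

theorem torusUniform_closedBall_le {d n : ℕ} [NeZero n] (z : FlatTorus d n) {r : ℝ} (hr : 0 ≤ r) :
    (torusUniform d n).real (Metric.closedBall z r) ≤ (2 * r) ^ d / n := by
  rw [torusUniform_closedBall z hr]
  have h0 : 0 ≤ min (torusSide d n) (2 * r) := le_min (torusSide_pos' d n).le (by positivity)
  gcongr
  exact min_le_right _ _

theorem dist_le_torusDist {d n : ℕ} (x y : FlatTorus d n) : dist x y ≤ torusDist x y := by
  refine (dist_pi_le_iff (Real.sqrt_nonneg _)).mpr fun k => Real.le_sqrt_of_sq_le ?_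
  rw [dist_eq_norm]
  exact Finset.single_le_sum (f := fun k => ‖x k - y k‖ ^ 2) (fun i _ => sq_nonneg _)
    (Finset.mem_univ k)

theorem torusDist_le_dist {d n : ℕ} (x y : FlatTorus d n) : torusDist x y ≤ d * dist x y := by
  refine Real.sqrt_le_iff.mpr ⟨by positivity, ?_⟩
  calc ∑ k, ‖x k - y k‖ ^ 2 ≤ ∑ _k : Fin d, dist x y ^ 2 := by
        refine Finset.sum_le_sum fun k _ => ?_
        rw [← dist_eq_norm]
        exact pow_le_pow_left₀ dist_nonneg (dist_le_pi_dist x y k) 2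
    _ = d * dist x y ^ 2 := by simp
    _ ≤ (d * dist x y) ^ 2 := by
        rw [mul_pow]
        have : (d : ℝ) ≤ (d : ℝ) ^ 2 := by exact_mod_cast Nat.le_self_pow two_ne_zero d
        gcongr

theorem torusDist_comm {d n : ℕ} (x y : FlatTorus d n) : torusDist x y = torusDist y x := by
  simp only [torusDist, norm_sub_rev]

/-- The points of a cubic grid with `g` points per side on the flat torus. -/
noncomputable def torusGrid {d n g : ℕ} (a : Fin d → Fin g) : FlatTorus d n :=
  fun k => ((a k * (torusSide d n / g) : ℝ) : AddCircle (torusSide d n))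

theorem le_dist_torusGrid {d n g : ℕ} [NeZero n] {a b : Fin d → Fin g} (hab : a ≠ b) :
    torusSide d n / g ≤ dist (torusGrid a : FlatTorus d n) (torusGrid b) := by
  obtain ⟨k, hk⟩ := Function.ne_iff.mp hab
  refine le_trans ?_ (dist_le_pi_dist _ _ k)
  have hs := torusSide_pos' d n
  have hg : (0 : ℝ) < g := by exact_mod_cast (a k).pos
  set h := torusSide d n / g with hh
  have hh0 : 0 < h := by positivity
  rw [dist_eq_norm, torusGrid, torusGrid, ← AddCircle.coe_sub, AddCircle.norm_eq]
  set m := round ((torusSide d n)⁻¹ * ((a k : ℕ) * h - (b k : ℕ) * h))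
  have e : (a k : ℕ) * h - (b k : ℕ) * h - m * torusSide d n
      = (((a k : ℕ) - (b k : ℕ) - m * g : ℤ) : ℝ) * h := by
    push_cast
    rw [hh]; field_simp
  rw [e, abs_mul, abs_of_pos hh0]
  refine le_mul_of_one_le_left hh0.le ?_
  rw [← Int.cast_abs]
  -- Distinct indices below `g` stay distinct modulo `g`, so winding around the torus cannot bring
  -- grid points closer than one spacing.
  have : ((a k : ℕ) - (b k : ℕ) - m * g : ℤ) ≠ 0 := by
    intro h0
    have h1 : ((a k : ℕ) : ℤ) ≡ (b k : ℕ) [ZMOD g] :=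
      (Int.modEq_iff_dvd.mpr ⟨m, by linarith⟩ : ((b k : ℕ) : ℤ) ≡ (a k : ℕ) [ZMOD g]).symm
    have h2 := Int.natCast_modEq_iff.mp h1
    exact hk (Fin.ext (Nat.ModEq.eq_of_lt_of_lt h2 (a k).2 (b k).2))
  exact_mod_cast Int.one_le_abs this

theorem exists_dist_torusGrid_le {d n g : ℕ} [NeZero n] (hg : 0 < g) (x : FlatTorus d n) :
    ∃ a : Fin d → Fin g, dist x (torusGrid a) ≤ torusSide d n / g := by
  have hs := torusSide_pos' d n
  have hg' : (0 : ℝ) < g := by exact_mod_cast hg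
  have hh0 : 0 < torusSide d n / g := by positivity
  have key : ∀ k, ∃ a : Fin g, dist (x k) (((a : ℕ) * (torusSide d n / g) : ℝ) :
      AddCircle (torusSide d n)) ≤ torusSide d n / g := by
    intro k
    obtain ⟨y, hy, hyx⟩ := AddCircle.coe_image_Ico_eq (torusSide d n) 0 ▸ Set.mem_univ (x k)
    rw [zero_add] at hy
    have h0 : 0 ≤ y / (torusSide d n / g) := div_nonneg hy.1 hh0.le
    refine ⟨⟨⌊y / (torusSide d n / g)⌋₊, ?_⟩, ?_⟩
    · rw [Nat.floor_lt h0, div_lt_iff₀ hh0, mul_div_cancel₀ _ hg'.ne']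
      exact hy.2
    · rw [← hyx, dist_eq_norm, ← AddCircle.coe_sub]
      refine (QuotientAddGroup.norm_mk_le_norm).trans ?_
      have h1 := Nat.floor_le h0
      have h2 := (Nat.lt_floor_add_one (y / (torusSide d n / g))).le
      rw [le_div_iff₀ hh0] at h1
      rw [div_le_iff₀ hh0] at h2
      rw [Real.norm_eq_abs, abs_le]
      constructor <;> simp only <;> linarith
  choose a ha using key
  exact ⟨a, (dist_pi_le_iff hh0.le).mpr ha⟩

/-! ### A shell pattern forces a large degree. -/

/-- The region in which the point of block `k` has to lie, for a point near `z` to get a new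
neighbor in every block `0 < k < K`. -/
def shellTarget {d n : ℕ} (z : FlatTorus d n) (ρ : ℕ → ℝ) (K k : ℕ) : Set (FlatTorus d n) :=
  if k = 0 then Metric.closedBall z (ρ K)
  else Metric.closedBall z (ρ k) \ Metric.ball z ((2 * d + 2) * ρ (k + 1))

/-- The region which all but one of the points of block `k` have to avoid. -/
def shellGuard {d n : ℕ} (z : FlatTorus d n) (ρ : ℕ → ℝ) (k : ℕ) : Set (FlatTorus d n) :=
  Metric.ball z ((2 * d + 2) * ρ k)

theorem le_graphMaxDegree_add_one {d n : ℕ} {x : Fin n → FlatTorus d n} {G : SimpleGraph (Fin n)}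
    (hG : IsNNTree x G) {b : Fin n → ℕ} (hb : Monotone b) {ρ : ℕ → ℝ} (hρ0 : ∀ k, 0 < ρ k)
    (hρ : Antitone ρ) {K : ℕ} {z : FlatTorus d n}
    (hx : x ∈ labelledPattern b K (shellTarget z ρ K) (shellGuard z ρ)) :
    K ≤ graphMaxDegree G + 1 := by
  classical
  rcases Nat.eq_zero_or_pos K with rfl | hK
  · exact Nat.zero_le _
  obtain ⟨p, hp, hadj⟩ := hG
  have hne : Nonempty (Fin n) := ⟨(hx 0 hK).choose⟩
  choose! i hib hiA hiB using hx
  have hparent : ∀ k, 0 < k → k < K → p (i k) = i 0 := by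
    intro k hk0 hkK
    have hlt : i 0 < i k := by
      by_contra h
      have := hb (not_lt.mp h)
      rw [hib k hkK, hib 0 hK] at this
      omega
    have hpos : 0 < ((i k : Fin n) : ℕ) := lt_of_le_of_lt (Nat.zero_le _) hlt
    obtain ⟨hpl, hpmin⟩ := hp (i k) hpos
    by_contra hj
    set j := p (i k) with hjdef
    have hD : (0 : ℝ) ≤ 2 * d + 2 := by positivity
    have hlk : b j ≤ k := hib k hkK ▸ hb hpl.le
    have hlK : b j < K := lt_of_le_of_lt hlk hkK
    -- An earlier point other than `i 0` is far from `z`: a selected one of block `l` with `0 < l <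
    -- k` avoids the ball of radius `(2 * d + 2) * ρ (l + 1)`, and `l + 1 ≤ k`; an unselected one
    -- avoids the guard ball of its own block.
    have hfar : (2 * d + 2) * ρ k ≤ dist (x j) z := by
      by_cases hji : j = i (b j)
      · have h0 : b j ≠ 0 := fun h => hj (by rw [hji, h])
        have h1 : b j ≠ k := fun h => hpl.ne (by rw [hji, h])
        have h2 := hiA (b j) hlK
        rw [← hji, shellTarget, if_neg h0] at h2
        have h3 := h2.2
        rw [Metric.mem_ball, not_lt] at h3
        refine le_trans (mul_le_mul_of_nonneg_left (hρ ?_) hD) h3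
        omega
      · have h2 := hiB (b j) hlK j rfl hji
        rw [shellGuard, Metric.mem_ball, not_lt] at h2
        exact le_trans (mul_le_mul_of_nonneg_left (hρ hlk) hD) h2
    have hk : dist (x (i k)) z ≤ ρ k := by
      have h2 := hiA k hkK
      rw [shellTarget, if_neg hk0.ne'] at h2
      exact h2.1
    have h0 : dist (x (i 0)) z ≤ ρ k := by
      have h2 := hiA 0 hK
      rw [shellTarget, if_pos rfl] at h2
      exact le_trans h2 (hρ hkK.le)
    have h1 := hpmin (i 0) hlt
    have h2 := dist_le_torusDist (x (i k)) (x j)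
    have h3 := torusDist_le_dist (x (i k)) (x (i 0))
    have h4 : dist (x (i k)) (x (i 0)) ≤ 2 * ρ k := by
      have := dist_triangle_right (x (i k)) (x (i 0)) z
      linarith
    have h5 : dist (x j) z ≤ dist (x (i k)) (x j) + dist (x (i k)) z := dist_triangle_left _ _ _
    have h6 : (d : ℝ) * dist (x (i k)) (x (i 0)) ≤ d * (2 * ρ k) := by gcongr
    -- Being the parent would put `x j` within `2 * d * ρ k` of `x (i k)`, hence within `(2 * d + 1)
    -- * ρ k` of `z`.
    have := hρ0 k
    linarith
  have hsub : (Finset.Ico 1 K).image i ⊆ G.neighborFinset (i 0) := by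
    intro w hw
    obtain ⟨k, hk, rfl⟩ := Finset.mem_image.mp hw
    obtain ⟨hk1, hkK⟩ := Finset.mem_Ico.mp hk
    rw [SimpleGraph.mem_neighborFinset, hadj]
    refine Or.inr ⟨?_, hparent k hk1 hkK⟩
    by_contra h
    have h1 : i k ≤ i 0 := by
      rw [Fin.le_def]; omega
    have := hb h1
    rw [hib k hkK, hib 0 hK] at this
    omega
  have hcard : ((Finset.Ico 1 K).image i).card = K - 1 := by
    rw [Finset.card_image_of_injOn, Nat.card_Ico]
    intro k hk l hl hkl
    have hk' := Finset.mem_Ico.mp hk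
    have hl' := Finset.mem_Ico.mp hl
    rw [← hib k hk'.2, ← hib l hl'.2, hkl]
  have h1 := Finset.card_le_card hsub
  rw [hcard, SimpleGraph.card_neighborFinset_eq_degree] at h1
  have h2 : G.degree (i 0) ≤ graphMaxDegree G := by
    rw [graphMaxDegree]
    convert G.degree_le_maxDegree (i 0)
  omega

/-! ### Deterministic upper bound by packing at dyadic scales. -/

theorem AddCircle.exists_abs_eq_norm {p : ℝ} (x : AddCircle p) :
    ∃ a : ℝ, (a : AddCircle p) = x ∧ |a| = ‖x‖ := by
  obtain ⟨y, rfl⟩ := QuotientAddGroup.mk_surjective x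
  refine ⟨y - round (p⁻¹ * y) * p, ?_, (AddCircle.norm_eq p).symm⟩
  have : (round (p⁻¹ * y) : ℝ) * p = round (p⁻¹ * y) • p := by simp
  rw [this, AddCircle.coe_sub, AddCircle.coe_zsmul, AddCircle.coe_period, smul_zero, sub_zero]

/-- Shortest real lifts of the offsets from `z` are rounded to cubes of side `r / (2 * d)`. Two
points in one cube would be at torus distance at most `r / 2`, and each coordinate takes at most `8
* d + 1` rounded values. Wrapping around is harmless, since passing to the quotient only shortens
distances. -/
theorem card_le_of_le_torusDist {d n : ℕ} [NeZero n] {ι : Type*} (W : Finset ι)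
    (y : ι → FlatTorus d n) (z : FlatTorus d n) {r : ℝ} (hr : 0 < r)
    (hz : ∀ w ∈ W, dist (y w) z ≤ 2 * r)
    (hsep : ∀ w ∈ W, ∀ w' ∈ W, w ≠ w' → r ≤ torusDist (y w) (y w')) :
    W.card ≤ (8 * d + 1) ^ d := by
  classical
  rcases Nat.eq_zero_or_pos d with rfl | hd
  · have : W.card ≤ 1 := Finset.card_le_one.mpr fun w hw w' hw' => by
      by_contra h
      have h1 := hsep w hw w' hw' h
      have h2 := torusDist_le_dist (y w) (y w')
      simp only [Nat.cast_zero, zero_mul] at h2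
      linarith
    simpa using this
  choose a ha hna using fun w k => AddCircle.exists_abs_eq_norm (y w k - z k)
  have hd' : (0 : ℝ) < d := by exact_mod_cast hd
  let F : ι → Fin d → ℤ := fun w k => ⌊a w k * (2 * d / r)⌋
  have hF : ∀ w ∈ W, F w ∈ Fintype.piFinset fun _ : Fin d => Finset.Icc (-(4 * d) : ℤ) (4 * d) := by
    intro w hw
    rw [Fintype.mem_piFinset]
    intro k
    have h1 : |a w k| ≤ 2 * r := by
      rw [hna, ← dist_eq_norm]
      exact (dist_le_pi_dist _ _ k).trans (hz w hw)
    obtain ⟨h2, h3⟩ := abs_le.mp h1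
    have e : 2 * r * (2 * d / r) = 4 * d := by field_simp; ring
    have hpos : 0 < 2 * d / r := by positivity
    rw [Finset.mem_Icc]
    constructor
    · rw [Int.le_floor]
      push_cast
      nlinarith
    · have : (⌊a w k * (2 * d / r)⌋ : ℝ) ≤ (4 * d : ℤ) :=
        (Int.floor_le _).trans (by push_cast; nlinarith)
      exact Int.cast_le.mp this
  have hinj : Set.InjOn F W := by
    intro w hw w' hw' h
    by_contra hne
    have h1 := hsep w hw w' hw' hne
    have h2 : dist (y w) (y w') ≤ r / (2 * d) := by
      refine (dist_pi_le_iff (by positivity)).mpr fun k => ?_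
      have h3 := Int.abs_sub_lt_one_of_floor_eq_floor (congrFun h k)
      rw [← sub_mul, abs_mul, abs_of_pos (by positivity : 0 < 2 * d / r)] at h3
      have e : y w k - y w' k = ((a w k - a w' k : ℝ) : AddCircle (torusSide d n)) := by
        rw [AddCircle.coe_sub, ha, ha, sub_sub_sub_cancel_right]
      rw [dist_eq_norm, e]
      refine (QuotientAddGroup.norm_mk_le_norm).trans ?_
      rw [Real.norm_eq_abs, le_div_iff₀ (by positivity)]
      rw [mul_div_assoc', div_lt_iff₀ hr] at h3
      linarith
    have h4 := torusDist_le_dist (y w) (y w')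
    have h5 : d * dist (y w) (y w') ≤ d * (r / (2 * d)) := by gcongr
    have e : d * (r / (2 * d)) = r / 2 := by field_simp
    linarith
  have h := Finset.card_le_card_of_injOn F hF hinj
  rw [Fintype.card_piFinset] at h
  simp only [Int.card_Icc, Finset.prod_const, Finset.card_univ, Fintype.card_fin] at h
  convert h using 2
  omega

theorem dist_le_torusSide {d n : ℕ} [NeZero n] (x y : FlatTorus d n) :
    dist x y ≤ torusSide d n / 2 := by
  have hs := torusSide_pos' d n
  refine (dist_pi_le_iff (by positivity)).mpr fun k => ?_
  rw [dist_eq_norm]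
  simpa [abs_of_pos hs] using AddCircle.norm_le_half_period (torusSide d n) hs.ne' (x := x k - y k)

theorem graphMaxDegree_le {d n : ℕ} [NeZero n] {x : Fin n → FlatTorus d n}
    {G : SimpleGraph (Fin n)} (hG : IsNNTree x G) {r : ℝ} (hr : 0 < r) {m J : ℕ}
    (hm : ∀ v, (Finset.univ.filter fun w => dist (x w) (x v) ≤ r).card ≤ m)
    (hJ : d * torusSide d n ≤ 2 ^ J * r) :
    graphMaxDegree G ≤ 1 + m + J * (8 * d + 1) ^ d := by
  classical
  obtain ⟨p, hp, hadj⟩ := hG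
  have hdeg : ∀ v, G.degree v ≤ 1 + m + J * (8 * d + 1) ^ d := by
    intro v
    let W : ℕ → Finset (Fin n) := fun j => Finset.univ.filter fun w =>
      0 < (w : ℕ) ∧ p w = v ∧ 2 ^ j * r ≤ torusDist (x w) (x v) ∧
        torusDist (x w) (x v) < 2 ^ (j + 1) * r
    have hW : ∀ j, (W j).card ≤ (8 * d + 1) ^ d := by
      intro j
      refine card_le_of_le_torusDist (W j) x (x v) (r := 2 ^ j * r) (by positivity) ?_ ?_
      · intro w hw
        have h := (Finset.mem_filter.mp hw).2.2.2.2
        have := dist_le_torusDist (x w) (x v)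
        rw [pow_succ] at h
        linarith
      -- The later child `w'` chose `v` although `w` was available, so `w` is no closer to it than
      -- `v`.
      · have key : ∀ w ∈ W j, ∀ w' ∈ W j, w < w' → 2 ^ j * r ≤ torusDist (x w') (x w) := by
          intro w _ w' hw' hlt
          obtain ⟨h0, h1, h2, _⟩ := (Finset.mem_filter.mp hw').2
          have := (hp w' h0).2 w hlt
          rw [h1] at this
          exact h2.trans this
        intro w hw w' hw' hne
        rcases lt_or_gt_of_ne hne with h | h
        · rw [torusDist_comm]; exact key w hw w' hw' h
        · exact key w' hw' w hw h
    have hsub : G.neighborFinset v ⊆ {p v} ∪ (Finset.univ.filter fun w => dist (x w) (x v) ≤ r) ∪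
        (Finset.range J).biUnion W := by
      intro w hw
      rw [SimpleGraph.mem_neighborFinset, hadj] at hw
      rcases hw with ⟨_, h⟩ | ⟨h0, h⟩
      · simp [h]
      · by_cases hc : dist (x w) (x v) ≤ r
        · simp [hc]
        refine Finset.mem_union_right _ ?_
        have hlt : r < torusDist (x w) (x v) := (not_le.mp hc).trans_le (dist_le_torusDist _ _)
        obtain ⟨j, hj1, hj2⟩ := exists_nat_pow_near ((one_le_div hr).mpr hlt.le) one_lt_two
        rw [le_div_iff₀ hr] at hj1
        rw [div_lt_iff₀ hr] at hj2
        refine Finset.mem_biUnion.mpr ⟨j, ?_, Finset.mem_filter.mpr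
          ⟨Finset.mem_univ _, h0, h, hj1, hj2⟩⟩
        rw [Finset.mem_range]
        by_contra hjJ
        have h1 : (2 : ℝ) ^ J * r ≤ 2 ^ j * r := by
          gcongr
          · norm_num
          · omega
        have h2 := torusDist_le_dist (x w) (x v)
        have h3 : d * dist (x w) (x v) ≤ d * (torusSide d n / 2) := by
          gcongr; exact dist_le_torusSide _ _
        linarith
    rw [← SimpleGraph.card_neighborFinset_eq_degree]
    refine (Finset.card_le_card hsub).trans ((Finset.card_union_le _ _).trans ?_)
    refine add_le_add ((Finset.card_union_le _ _).trans ?_) ?_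
    · rw [Finset.card_singleton]
      exact Nat.add_le_add_left (hm v) 1
    · refine Finset.card_biUnion_le.trans ?_
      simpa using Finset.sum_le_sum fun j (_ : j ∈ Finset.range J) => hW j
  rw [graphMaxDegree]
  refine SimpleGraph.maxDegree_le_of_forall_degree_le _ _ fun v => ?_
  convert hdeg v

/-! ### Crowded small balls are unlikely. -/

theorem measureReal_le_card_filter_mem {X : Type*} [MeasurableSpace X] (μ : Measure X)
    [IsProbabilityMeasure μ] (n m : ℕ) (S : Set X) [DecidablePred (· ∈ S)] :
    (Measure.pi fun _ : Fin n => μ).real {x | m ≤ (Finset.univ.filter fun w => x w ∈ S).card}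
      ≤ (n * μ.real S) ^ m := by
  classical
  have hsub : {x : Fin n → X | m ≤ (Finset.univ.filter fun w => x w ∈ S).card}
      ⊆ ⋃ T ∈ Finset.powersetCard m (Finset.univ : Finset (Fin n)),
        Set.univ.pi fun w => if w ∈ T then S else Set.univ := by
    intro x hx
    obtain ⟨T, hT, hTc⟩ := Finset.exists_subset_card_eq hx
    refine Set.mem_iUnion₂.mpr ⟨T, Finset.mem_powersetCard.mpr ⟨Finset.subset_univ _, hTc⟩, ?_⟩
    intro w _
    by_cases hw : w ∈ T
    · simpa [hw] using hT hw
    · simp [hw]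
  have hpi : ∀ T ∈ Finset.powersetCard m (Finset.univ : Finset (Fin n)),
      (Measure.pi fun _ : Fin n => μ).real (Set.univ.pi fun w => if w ∈ T then S else Set.univ)
        = μ.real S ^ m := by
    intro T hT
    rw [measureReal_def, Measure.pi_pi, ENNReal.toReal_prod]
    have : ∀ w, (μ (if w ∈ T then S else Set.univ)).toReal = if w ∈ T then μ.real S else 1 := by
      intro w
      split_ifs <;> simp [measureReal_def]
    simp only [this]
    rw [Finset.prod_ite_mem, Finset.univ_inter, Finset.prod_const, (Finset.mem_powersetCard.mp hT).2]
  calc _ ≤ ∑ T ∈ Finset.powersetCard m (Finset.univ : Finset (Fin n)),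
        (Measure.pi fun _ : Fin n => μ).real (Set.univ.pi fun w => if w ∈ T then S else Set.univ) :=
        (measureReal_mono hsub (measure_ne_top _ _)).trans (measureReal_biUnion_finset_le _ _)
    _ = (n.choose m : ℝ) * μ.real S ^ m := by
        rw [Finset.sum_congr rfl hpi, Finset.sum_const, Finset.card_powersetCard, Finset.card_univ,
          Fintype.card_fin, nsmul_eq_mul]
    _ ≤ (n : ℝ) ^ m * μ.real S ^ m := by
        gcongr
        exact_mod_cast Nat.choose_le_pow n m
    _ = _ := (mul_pow _ _ _).symm

-- A grid of `n ^ (2 * d)` fixed centres replaces the random centres: its spacing is at most `1 /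
-- n`, so doubling the radius suffices. The expected number of points in such a doubled ball is at
-- most `(4 / n) ^ d ≤ 4 / n`.
open Classical in
theorem measureReal_exists_crowded_le {d n : ℕ} [NeZero n] (hd : 1 ≤ d) (hn : 4 ≤ n) (m : ℕ) :
    (Measure.pi fun _ : Fin n => torusUniform d n).real
        {x | ∃ v, m ≤ (Finset.univ.filter fun w => dist (x w) (x v) ≤ 1 / (n : ℝ)).card}
      ≤ (n : ℝ) ^ (2 * d) * (4 / n) ^ m := by
  have := isProbabilityMeasure_torusUniform (n := n) hd
  have hn0 : (0 : ℝ) < n := by positivity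
  have hn4 : (4 : ℝ) ≤ n := by exact_mod_cast hn
  have hgrid : torusSide d n / (n ^ 2 : ℕ) ≤ 1 / n := by
    rw [div_le_div_iff₀ (by positivity) hn0]
    have := torusSide_le (n := n) hd
    push_cast
    nlinarith
  have hsub : {x : Fin n → FlatTorus d n |
        ∃ v, m ≤ (Finset.univ.filter fun w => dist (x w) (x v) ≤ 1 / (n : ℝ)).card}
      ⊆ ⋃ a ∈ (Finset.univ : Finset (Fin d → Fin (n ^ 2))), {x : Fin n → FlatTorus d n |
        m ≤ (Finset.univ.filter fun w => x w ∈ Metric.closedBall (torusGrid a) (2 / (n : ℝ))).card} := by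
    rintro x ⟨v, hv⟩
    obtain ⟨a, ha⟩ := exists_dist_torusGrid_le (g := n ^ 2) (by positivity) (x v)
    refine Set.mem_iUnion₂.mpr ⟨a, Finset.mem_univ _, hv.trans (Finset.card_le_card ?_)⟩
    intro w hw
    have hw' := (Finset.mem_filter.mp hw).2
    refine Finset.mem_filter.mpr ⟨Finset.mem_univ _, ?_⟩
    rw [Metric.mem_closedBall]
    have := dist_triangle (x w) (x v) (torusGrid a)
    have e : 2 / (n : ℝ) = 1 / n + 1 / n := by ring
    linarith
  have hone : ∀ z : FlatTorus d n,
      n * (torusUniform d n).real (Metric.closedBall z (2 / (n : ℝ))) ≤ 4 / n := by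
    intro z
    have h1 := torusUniform_closedBall_le z (r := 2 / (n : ℝ)) (by positivity)
    have h2 : (2 * (2 / (n : ℝ))) ^ d ≤ 4 / n := by
      have e : 2 * (2 / (n : ℝ)) = 4 / n := by ring
      rw [e]
      exact pow_le_of_le_one (by positivity) ((div_le_one hn0).mpr hn4) (by omega)
    calc n * (torusUniform d n).real (Metric.closedBall z (2 / (n : ℝ)))
        ≤ n * ((2 * (2 / (n : ℝ))) ^ d / n) := by gcongr
      _ = (2 * (2 / (n : ℝ))) ^ d := by field_simp
      _ ≤ _ := h2
  calc _ ≤ ∑ a ∈ (Finset.univ : Finset (Fin d → Fin (n ^ 2))),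
        (Measure.pi fun _ : Fin n => torusUniform d n).real {x : Fin n → FlatTorus d n |
          m ≤ (Finset.univ.filter fun w =>
            x w ∈ Metric.closedBall (torusGrid a) (2 / (n : ℝ))).card} :=
        (measureReal_mono hsub (measure_ne_top _ _)).trans (measureReal_biUnion_finset_le _ _)
    _ ≤ ∑ _a ∈ (Finset.univ : Finset (Fin d → Fin (n ^ 2))), (4 / (n : ℝ)) ^ m := by
        refine Finset.sum_le_sum fun a _ => ?_
        refine (measureReal_le_card_filter_mem (torusUniform d n) n m
          (Metric.closedBall (torusGrid a) (2 / (n : ℝ)))).trans ?_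
        exact pow_le_pow_left₀ (by positivity) (hone _) m
    _ = _ := by
        rw [Finset.sum_const, Finset.card_univ, nsmul_eq_mul]
        simp [pow_mul]

/-! ### Geometric time blocks. -/

/-- The label of the `i`-th point, when the successive blocks of points end at
`L`, `L * β`, `L * β ^ 2`, … -/
def geometricBlock (β L i : ℕ) : ℕ := Nat.clog β (i / L + 1)

theorem geometricBlock_le_iff {β L i k : ℕ} (hβ : 1 < β) (hL : 0 < L) :
    geometricBlock β L i ≤ k ↔ i < L * β ^ k := by
  rw [geometricBlock, Nat.clog_le_iff_le_pow hβ, Nat.succ_le_iff, Nat.div_lt_iff_lt_mul hL,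
    mul_comm]

theorem geometricBlock_mono (β L : ℕ) : Monotone (geometricBlock β L) := fun _ _ h =>
  Nat.clog_mono_right _ (Nat.succ_le_succ (Nat.div_le_div_right h))

theorem card_geometricBlock_le {β L n k : ℕ} (hβ : 1 < β) (hL : 0 < L) (hn : L * β ^ k ≤ n) :
    (Finset.univ.filter fun i : Fin n => geometricBlock β L i ≤ k).card = L * β ^ k := by
  simp only [geometricBlock_le_iff hβ hL]
  rw [Fin.card_filter_val_lt]
  exact min_eq_right hn

theorem card_geometricBlock_eq_le {β L n k : ℕ} (hβ : 1 < β) (hL : 0 < L) (hn : L * β ^ k ≤ n) :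
    (Finset.univ.filter fun i : Fin n => geometricBlock β L i = k).card ≤ L * β ^ k := by
  rw [← card_geometricBlock_le hβ hL hn]
  exact Finset.card_le_card fun i hi => by
    simp only [Finset.mem_filter, Finset.mem_univ, true_and] at hi ⊢
    exact hi.le

/-- As `β ≥ 2`, all blocks before the last one fill at most half of the time elapsed. -/
theorem le_two_mul_card_geometricBlock_eq {β L n k : ℕ} (hβ : 1 < β) (hL : 0 < L)
    (hn : L * β ^ k ≤ n) :
    L * β ^ k ≤ 2 * (Finset.univ.filter fun i : Fin n => geometricBlock β L i = k).card := by
  rcases k with _ | k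
  · have := card_geometricBlock_le hβ hL hn
    simp only [Nat.le_zero] at this
    omega
  · have h1 := card_geometricBlock_le hβ hL hn
    have hle : L * β ^ k * 2 ≤ L * β ^ (k + 1) := by
      rw [pow_succ, ← mul_assoc]
      exact Nat.mul_le_mul_left _ hβ
    have h2 := card_geometricBlock_le (n := n) hβ hL (k := k) (by omega)
    have h3 : (Finset.univ.filter fun i : Fin n => geometricBlock β L i ≤ k + 1)
        ⊆ (Finset.univ.filter fun i : Fin n => geometricBlock β L i ≤ k) ∪
          (Finset.univ.filter fun i : Fin n => geometricBlock β L i = k + 1) := fun i hi => by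
      simp only [Finset.mem_filter, Finset.mem_univ, true_and, Finset.mem_union] at hi ⊢
      omega
    have h4 := (Finset.card_le_card h3).trans (Finset.card_union_le _ _)
    omega

/-! ### Probability of the shell pattern at one centre. -/

theorem torusUniform_shell_ge {d n : ℕ} [NeZero n] (hd : 1 ≤ d) (z : FlatTorus d n) {r : ℝ}
    (hr : 0 ≤ r) (hrs : 2 * r ≤ torusSide d n) :
    r ^ d / n ≤ (torusUniform d n).real (Metric.closedBall z r \ Metric.ball z (r / 2)) := by
  have := isProbabilityMeasure_torusUniform (n := n) hd
  have hn0 : (0 : ℝ) < n := by exact_mod_cast NeZero.pos n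
  have h1 := torusUniform_closedBall z hr
  rw [min_eq_right hrs] at h1
  have h2 : (torusUniform d n).real (Metric.ball z (r / 2)) ≤ r ^ d / n := by
    refine (measureReal_mono Metric.ball_subset_closedBall).trans ?_
    have := torusUniform_closedBall_le z (r := r / 2) (by positivity)
    rwa [mul_div_cancel₀ _ two_ne_zero] at this
  have h3 := le_measureReal_sdiff (μ := torusUniform d n) (s₁ := Metric.closedBall z r)
    (s₂ := Metric.ball z (r / 2))
  have h4 : 2 * (r ^ d / n) ≤ (2 * r) ^ d / n := by
    rw [mul_pow, ← mul_div_assoc]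
    gcongr
    exact le_self_pow₀ one_le_two (by omega)
  linarith

theorem measurableSet_shellTarget {d n : ℕ} (z : FlatTorus d n) (ρ : ℕ → ℝ) (K k : ℕ) :
    MeasurableSet (shellTarget z ρ K k) := by
  rw [shellTarget]
  split_ifs
  · exact Metric.isClosed_closedBall.measurableSet
  · exact Metric.isClosed_closedBall.measurableSet.diff Metric.isOpen_ball.measurableSet

theorem shellTarget_subset_shellGuard {d n : ℕ} (z : FlatTorus d n) {ρ : ℕ → ℝ}
    (hρ0 : ∀ k, 0 < ρ k) (hρ : Antitone ρ) {K k : ℕ} (hk : k ≤ K) :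
    shellTarget z ρ K k ⊆ shellGuard z ρ k := by
  have h : ρ k < (2 * d + 2) * ρ k := by
    have := hρ0 k
    have : (0 : ℝ) ≤ d * ρ k := by positivity
    linarith
  rw [shellTarget, shellGuard]
  split_ifs
  · exact Metric.closedBall_subset_ball ((hρ hk).trans_lt h)
  · exact Set.sdiff_subset.trans (Metric.closedBall_subset_ball h)

theorem shellGuard_subset {d n : ℕ} (z : FlatTorus d n) {ρ : ℕ → ℝ} (hρ : Antitone ρ) (k : ℕ) :
    shellGuard z ρ k ⊆ shellGuard z ρ 0 :=
  Metric.ball_subset_ball (mul_le_mul_of_nonneg_left (hρ (Nat.zero_le k)) (by positivity))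

/-- The radii of the shells around the points of a grid with `g` points per side. -/
noncomputable def shellRadius (d n g k : ℕ) : ℝ := torusSide d n / g / (4 * d + 4) ^ (k + 1)

theorem shellRadius_pos {d n g : ℕ} [NeZero n] (hg : 0 < g) (k : ℕ) : 0 < shellRadius d n g k := by
  have := torusSide_pos' d n
  have : (0 : ℝ) < g := by exact_mod_cast hg
  rw [shellRadius]
  positivity

theorem shellRadius_antitone (d n g : ℕ) [NeZero n] : Antitone (shellRadius d n g) := fun k l h => by
  have := torusSide_pos' d n
  have h1 : (1 : ℝ) ≤ 4 * d + 4 := by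
    have : (0 : ℝ) ≤ d := by positivity
    linarith
  rw [shellRadius, shellRadius]
  gcongr

/-- The ratio `4 * d + 4` is chosen for this: the ball removed from the shell of block `k` has half
its radius, leaving a fixed fraction of the volume. -/
theorem shellRadius_succ (d n g k : ℕ) :
    (2 * d + 2) * shellRadius d n g (k + 1) = shellRadius d n g k / 2 := by
  rw [shellRadius, shellRadius, pow_succ _ (k + 1)]
  have : (4 * d + 4 : ℝ) ≠ 0 := by positivity
  field_simp
  ring

theorem shellRadius_pow {d n g : ℕ} (hd : 1 ≤ d) [NeZero n] (k : ℕ) :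
    shellRadius d n g k ^ d / n = 1 / (g ^ d * ((4 * d + 4) ^ d) ^ (k + 1)) := by
  have hn0 : (n : ℝ) ≠ 0 := by exact_mod_cast NeZero.ne n
  rw [shellRadius, div_pow, div_pow, torusSide_pow hd, pow_right_comm]
  field_simp

theorem two_mul_shellRadius_le {d n g : ℕ} [NeZero n] (hg : 0 < g) (k : ℕ) :
    2 * shellRadius d n g k ≤ torusSide d n := by
  have hs := torusSide_pos' d n
  have hg1 : (1 : ℝ) ≤ g := by exact_mod_cast hg
  have h1 := shellRadius_antitone d n g (Nat.zero_le k)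
  have h2 : shellRadius d n g 0 ≤ torusSide d n / 2 := by
    rw [shellRadius, div_div]
    gcongr
    have : (0 : ℝ) ≤ d := by positivity
    rw [zero_add, pow_one]
    nlinarith
  linarith

theorem le_torusUniform_shellTarget {d n g : ℕ} [NeZero n] (hd : 1 ≤ d) (hg : 0 < g)
    (z : FlatTorus d n) (K k : ℕ) :
    1 / (g ^ d * ((4 * d + 4) ^ d) ^ ((if k = 0 then K else k) + 1))
      ≤ (torusUniform d n).real (shellTarget z (shellRadius d n g) K k) := by
  have := isProbabilityMeasure_torusUniform (n := n) hd
  rw [← shellRadius_pow (n := n) hd]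
  have h := torusUniform_shell_ge hd z (shellRadius_pos (d := d) (n := n) hg
    (if k = 0 then K else k)).le (two_mul_shellRadius_le hg _)
  refine h.trans (measureReal_mono ?_)
  rw [shellTarget]
  split_ifs
  · exact Set.sdiff_subset
  · rw [shellRadius_succ]

theorem le_torusUniform_shellGuard_compl {d n g : ℕ} [NeZero n] (hd : 1 ≤ d) (hg : 0 < g)
    (z : FlatTorus d n) (k : ℕ) :
    1 - 1 / (g ^ d * ((4 * d + 4) ^ d) ^ k)
      ≤ (torusUniform d n).real (shellGuard z (shellRadius d n g) k)ᶜ := by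
  have := isProbabilityMeasure_torusUniform (n := n) hd
  have hn0 : (n : ℝ) ≠ 0 := by exact_mod_cast NeZero.ne n
  rw [shellGuard, probReal_compl_eq_one_sub (Metric.isOpen_ball.measurableSet)]
  refine sub_le_sub_left ?_ 1
  have hr := shellRadius_pos (d := d) (n := n) hg k
  refine (measureReal_mono Metric.ball_subset_closedBall).trans
    ((torusUniform_closedBall_le z (by positivity)).trans (le_of_eq ?_))
  have e : 2 * ((2 * d + 2) * shellRadius d n g k) = (4 * d + 4) * shellRadius d n g k := by ring
  rw [e, mul_pow, mul_div_assoc, shellRadius_pow hd, pow_succ]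
  field_simp

/-- With `β = (4 * d + 4) ^ d`, block size and ball volume at scale `k` balance: the powers `β ^ k`
cancel and each block contributes at least `1 / (16 * β)`. Only block 0, whose target has the tiny
radius `ρ K`, pays an extra `β ^ (-K)`. -/
theorem le_measureReal_shellPattern {d n g L K : ℕ} [NeZero n] (hd : 1 ≤ d) (hg : 0 < g)
    (hL : 0 < L) (hL2 : 2 * L ≤ g ^ d) (hL4 : g ^ d ≤ 4 * L) (hK : 0 < K)
    (hn : L * ((4 * d + 4) ^ d) ^ K ≤ n) (z : FlatTorus d n) :
    1 / (16 * (4 * d + 4) ^ d : ℝ) ^ (2 * K) ≤ (Measure.pi fun _ : Fin n => torusUniform d n).real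
      (labelledPattern (fun i => geometricBlock ((4 * d + 4) ^ d) L i) K
        (shellTarget z (shellRadius d n g) K) (shellGuard z (shellRadius d n g))) := by
  have := isProbabilityMeasure_torusUniform (n := n) hd
  have hβ : 1 < (4 * d + 4) ^ d := Nat.one_lt_pow (by omega) (by omega)
  set β : ℕ := (4 * d + 4) ^ d with hβdef
  have hβr : ((4 * d + 4) ^ d : ℝ) = β := by rw [hβdef]; push_cast; rfl
  have hβ1 : (1 : ℝ) ≤ β := by exact_mod_cast hβ.le
  set M : ℕ := g ^ d with hM
  have hMr : (g : ℝ) ^ d = M := by rw [hM]; push_cast; rfl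
  have hL0 : (0 : ℝ) < L := by exact_mod_cast hL
  have hM0 : (0 : ℝ) < M := by
    have : 0 < M := by omega
    exact_mod_cast this
  have hL2' : 2 * (L : ℝ) ≤ M := by exact_mod_cast hL2
  have hL4' : (M : ℝ) ≤ 4 * L := by exact_mod_cast hL4
  have hβ0 : (0 : ℝ) < β := by linarith
  let N : ℕ → ℕ := fun k => (Finset.univ.filter fun i : Fin n => geometricBlock β L i = k).card
  have hblock : ∀ k < K, L * β ^ k ≤ n := fun k hk =>
    (Nat.mul_le_mul_left _ (Nat.pow_le_pow_right (by omega) hk.le)).trans hn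
  have hN1 : ∀ k < K, (N k : ℝ) ≤ L * β ^ k := fun k hk => by
    exact_mod_cast card_geometricBlock_eq_le hβ hL (hblock k hk)
  have hN2 : ∀ k < K, (L : ℝ) * β ^ k ≤ 2 * N k := fun k hk => by
    exact_mod_cast le_two_mul_card_geometricBlock_eq hβ hL (hblock k hk)
  let a : ℕ → ℝ := fun k => 1 / (M * β ^ ((if k = 0 then K else k) + 1))
  let q : ℕ → ℝ := fun k => 1 - 1 / (M * β ^ k)
  have hq0 : ∀ k, 0 ≤ q k := fun k => by
    have h1 : (1 : ℝ) ≤ β ^ k := one_le_pow₀ hβ1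
    have h2 : (1 : ℝ) ≤ M := by
      have : 1 ≤ M := by omega
      exact_mod_cast this
    have : 1 / (M * (β : ℝ) ^ k) ≤ 1 := by
      rw [div_le_one (by positivity)]
      exact one_le_mul_of_one_le_of_one_le h2 h1
    simp only [q]
    linarith
  -- Bernoulli's inequality: `2 * L ≤ g ^ d` keeps the expected number of points of block `k` in the
  -- guard ball at most `1 / 2`.
  have hqpow : ∀ k < K, 1 / 2 ≤ q k ^ N k := fun k hk => by
    have h1 := one_add_mul_le_pow (a := -(1 / (M * (β : ℝ) ^ k)))
      (by have := hq0 k; simp only [q] at this; linarith) (N k)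
    have h2 : (N k : ℝ) * (1 / (M * (β : ℝ) ^ k)) ≤ 1 / 2 := by
      rw [mul_one_div, div_le_iff₀ (by positivity)]
      have := hN1 k hk
      have h3 : 2 * (L : ℝ) * β ^ k ≤ M * β ^ k := by gcongr
      linarith
    have e : q k = 1 + -(1 / (M * (β : ℝ) ^ k)) := by simp only [q]; ring
    rw [e]
    linarith
  have hfac : ∀ k < K, 1 / (16 * (β : ℝ)) * (if k = 0 then 1 / (β : ℝ) ^ K else 1)
      ≤ N k * (a k * q k ^ N k) := by
    intro k hk
    have ha : a k = 1 / (M * β ^ (k + 1)) * (if k = 0 then 1 / (β : ℝ) ^ K else 1) := by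
      simp only [a]
      split_ifs with h
      · subst h; rw [zero_add, pow_succ]; field_simp
      · rw [mul_one]
    have hnn : 0 ≤ (if k = 0 then 1 / (β : ℝ) ^ K else 1) := by split_ifs <;> positivity
    have h1 : 1 / (16 * (β : ℝ)) ≤ L * β ^ k / 2 * (1 / (M * β ^ (k + 1)) * (1 / 2)) := by
      have e : L * β ^ k / 2 * (1 / (M * β ^ (k + 1)) * (1 / 2)) = L / (4 * M * (β : ℝ)) := by
        rw [pow_succ]; field_simp; ring
      rw [e, div_le_div_iff₀ (by positivity) (by positivity)]
      nlinarith
    have h2 : L * β ^ k / 2 * (1 / (M * β ^ (k + 1)) * (1 / 2))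
        ≤ N k * (1 / (M * β ^ (k + 1)) * q k ^ N k) := by
      have := hN2 k hk
      exact mul_le_mul (by linarith) (mul_le_mul_of_nonneg_left (hqpow k hk) (by positivity))
        (by positivity) (Nat.cast_nonneg _)
    rw [ha]
    calc _ ≤ N k * (1 / (M * (β : ℝ) ^ (k + 1)) * q k ^ N k) *
          (if k = 0 then 1 / (β : ℝ) ^ K else 1) := mul_le_mul_of_nonneg_right (h1.trans h2) hnn
      _ = _ := by ring
  have hρ0 := fun k => shellRadius_pos (d := d) (n := n) hg k
  have hρ := shellRadius_antitone d n g
  have key := prod_le_measureReal_labelledPattern (torusUniform d n)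
    (fun i : Fin n => geometricBlock β L i) K (A := shellTarget z (shellRadius d n g) K)
    (B := shellGuard z (shellRadius d n g)) (measurableSet_shellTarget z _ K)
    (fun k => Metric.isOpen_ball.measurableSet)
    (fun k hk => shellTarget_subset_shellGuard z hρ0 hρ hk.le) (a := a) (q := q)
    (fun k _ => by simp only [a]; positivity) (fun k _ => hq0 k)
    (fun k _ => by
      have := le_torusUniform_shellTarget hd hg z K k
      rwa [hβr, hMr] at this)
    (fun k _ => by
      have := le_torusUniform_shellGuard_compl hd hg z k
      rwa [hβr, hMr] at this)
  refine le_trans ?_ key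
  rw [hβr]
  calc 1 / (16 * (β : ℝ)) ^ (2 * K) ≤ (1 / (16 * (β : ℝ))) ^ K * (1 / (β : ℝ) ^ K) := by
        rw [one_div_pow, one_div_mul_one_div, two_mul, pow_add]
        gcongr
        linarith
    _ = ∏ k : Fin K, (1 / (16 * (β : ℝ)) * (if (k : ℕ) = 0 then 1 / (β : ℝ) ^ K else 1)) := by
        rw [Finset.prod_mul_distrib, Finset.prod_const, Finset.card_univ, Fintype.card_fin]
        obtain ⟨K', rfl⟩ := Nat.exists_eq_succ_of_ne_zero hK.ne'
        rw [Fin.prod_univ_succ]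
        simp only [Fin.val_zero, if_true, Fin.val_succ, Nat.succ_ne_zero, if_false,
          Finset.prod_const_one, mul_one]
    _ ≤ _ := Finset.prod_le_prod (fun k _ => by split_ifs <;> positivity) fun k _ => hfac k k.2

/-! ### Lower and upper tails of the maximum degree. -/

theorem measureReal_graphMaxDegree_small_le {d n K : ℕ} [NeZero n] (hd : 1 ≤ d) (hK : 0 < K)
    (hn : (16 * (4 * d + 4) ^ d : ℝ) ^ (16 * K) ≤ n) :
    (Measure.pi fun _ : Fin n => torusUniform d n).real
      {x | ∃ G, IsNNTree x G ∧ graphMaxDegree G + 1 < K} ≤ Real.exp (-(Real.sqrt n / 8)) := by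
  have := isProbabilityMeasure_torusUniform (n := n) hd
  have hs := torusSide_pos' d n
  have hn0 : (0 : ℝ) < n := by exact_mod_cast NeZero.pos n
  set e : ℝ := 4 * d + 4 with he
  have he2 : 2 ≤ e := by
    have : (0 : ℝ) ≤ d := by positivity
    linarith
  set Q : ℝ := 16 * e ^ d with hQ
  have heQ : e ^ d ≤ Q := by
    have : 0 ≤ e ^ d := by positivity
    linarith
  have hQ1 : 1 ≤ Q := (one_le_pow₀ (by linarith)).trans heQ
  have hsmall : (2 * e ^ K) ^ d ≤ Q ^ (2 * K) := by
    rw [mul_pow, pow_right_comm, two_mul, pow_add]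
    gcongr
    calc (2 : ℝ) ^ d ≤ e ^ d := by gcongr
      _ ≤ Q := heQ
      _ ≤ Q ^ K := le_self_pow₀ hQ1 hK.ne'
  have hside : 2 * e ^ K ≤ torusSide d n := by
    refine (pow_le_pow_iff_left₀ (by positivity) hs.le (by omega : d ≠ 0)).mp ?_
    rw [torusSide_pow hd]
    exact (hsmall.trans (pow_le_pow_right₀ hQ1 (by omega))).trans hn
  -- The finest grid for which `K` blocks starting at time about `g ^ d / 2` surely fit into `n`
  -- points; rounding down costs at most a factor 2 per side.
  set g : ℕ := ⌊torusSide d n / e ^ K⌋₊ with hgdef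
  have hq2 : 2 ≤ torusSide d n / e ^ K := by rwa [le_div_iff₀ (by positivity)]
  have hg2 : 2 ≤ g := Nat.le_floor (by exact_mod_cast hq2)
  have hg0 : 0 < g := by omega
  have hgr : (0 : ℝ) < g := by exact_mod_cast hg0
  have hgle : (g : ℝ) ≤ torusSide d n / e ^ K := Nat.floor_le (by positivity)
  have hgge : torusSide d n / (2 * e ^ K) ≤ g := by
    have h1 : torusSide d n / e ^ K < g + 1 := Nat.lt_floor_add_one _
    have h2 : torusSide d n / (2 * e ^ K) = torusSide d n / e ^ K / 2 := by
      rw [div_div, mul_comm]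
    have h3 : (2 : ℝ) ≤ g := by exact_mod_cast hg2
    rw [h2]
    linarith
  have hM2 : 2 ≤ g ^ d := hg2.trans (Nat.le_self_pow (by omega) g)
  have hMle : (g : ℝ) ^ d * (e ^ d) ^ K ≤ n := by
    rw [le_div_iff₀ (by positivity)] at hgle
    rw [← torusSide_pow (n := n) hd, pow_right_comm, ← mul_pow]
    gcongr
  have hMge : n / Q ^ (2 * K) ≤ (g : ℝ) ^ d := by
    calc n / Q ^ (2 * K) ≤ n / (2 * e ^ K) ^ d := by gcongr
      _ = (torusSide d n / (2 * e ^ K)) ^ d := by rw [div_pow, torusSide_pow hd]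
      _ ≤ _ := by gcongr
  have hLn : g ^ d / 2 * ((4 * d + 4) ^ d) ^ K ≤ n := by
    have h1 : g ^ d * ((4 * d + 4) ^ d) ^ K ≤ n := by
      have : ((g ^ d * ((4 * d + 4) ^ d) ^ K : ℕ) : ℝ) ≤ n := by
        push_cast
        exact hMle
      exact_mod_cast this
    exact (Nat.mul_le_mul_right _ (Nat.div_le_self _ _)).trans h1
  have hρ0 := fun k => shellRadius_pos (d := d) (n := n) hg0 k
  have hρ := shellRadius_antitone d n g
  have hdisj : Set.PairwiseDisjoint ((Finset.univ : Finset (Fin d → Fin g)) : Set (Fin d → Fin g))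
      fun a => shellGuard (torusGrid a : FlatTorus d n) (shellRadius d n g) 0 := by
    intro a _ a' _ haa
    -- The outermost guard radius is exactly half the grid spacing.
    refine Metric.ball_disjoint_ball (le_trans (le_of_eq ?_) (le_dist_torusGrid haa))
    rw [shellRadius, zero_add, pow_one]
    field_simp
    ring
  have hcount : n / Q ^ (4 * K) ≤ ∑ a ∈ (Finset.univ : Finset (Fin d → Fin g)),
      (Measure.pi fun _ : Fin n => torusUniform d n).real
        (labelledPattern (fun i => geometricBlock ((4 * d + 4) ^ d) (g ^ d / 2) i) K
          (shellTarget (torusGrid a : FlatTorus d n) (shellRadius d n g) K)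
          (shellGuard (torusGrid a : FlatTorus d n) (shellRadius d n g))) := by
    calc n / Q ^ (4 * K) = n / Q ^ (2 * K) * (1 / Q ^ (2 * K)) := by
          rw [div_mul_div_comm, mul_one, ← pow_add]
          congr 2
          ring
      _ ≤ (g : ℝ) ^ d * (1 / Q ^ (2 * K)) := by gcongr
      _ = ∑ _a ∈ (Finset.univ : Finset (Fin d → Fin g)), 1 / Q ^ (2 * K) := by
          rw [Finset.sum_const, Finset.card_univ, nsmul_eq_mul]
          simp
      _ ≤ _ := Finset.sum_le_sum fun a _ => le_measureReal_shellPattern hd hg0 (by omega)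
          (by omega) (by omega) hK hLn _
  have key := measure_forall_notMem_labelledPattern_le (torusUniform d n) (NeZero.pos n)
    (fun i : Fin n => geometricBlock ((4 * d + 4) ^ d) (g ^ d / 2) i) K
    (Finset.univ : Finset (Fin d → Fin g))
    (A := fun a => shellTarget (torusGrid a : FlatTorus d n) (shellRadius d n g) K)
    (B := fun a => shellGuard (torusGrid a : FlatTorus d n) (shellRadius d n g))
    (U := fun a => shellGuard (torusGrid a : FlatTorus d n) (shellRadius d n g) 0)
    (fun a k => measurableSet_shellTarget _ _ K k)
    (fun a k => Metric.isOpen_ball.measurableSet)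
    (fun a k hk => (shellTarget_subset_shellGuard _ hρ0 hρ hk.le).trans (shellGuard_subset _ hρ k))
    (fun a k _ => shellGuard_subset _ hρ k) hdisj (by positivity) hcount
  refine (measureReal_mono ?_ (measure_ne_top _ _)).trans (key.trans (Real.exp_le_exp.mpr ?_))
  · rintro x ⟨G, hG, hdeg⟩ a _ hx
    have := le_graphMaxDegree_add_one hG
      (fun i j hij => geometricBlock_mono _ _ hij) hρ0 hρ hx
    omega
  · have hQn : Q ^ (8 * K) ≤ Real.sqrt n := by
      refine Real.le_sqrt_of_sq_le ?_
      rw [← pow_mul]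
      convert hn using 2
      ring
    have e1 : (n / Q ^ (4 * K)) ^ 2 / (8 * n) = n / Q ^ (8 * K) / 8 := by
      rw [div_pow, ← pow_mul]
      have : 4 * K * 2 = 8 * K := by ring
      rw [this]
      field_simp
    have h1 : Real.sqrt n ≤ n / Q ^ (8 * K) := by
      rw [le_div_iff₀ (by positivity)]
      calc Real.sqrt n * Q ^ (8 * K) ≤ Real.sqrt n * Real.sqrt n := by gcongr
        _ = n := Real.mul_self_sqrt hn0.le
    rw [e1]
    linarith

/-- Only an inequality is claimed, because `S` need not be measurable: it will quantify over all
trees, that is, over all tie-breakings. -/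
theorem IsRandomNNTree.measure_preimage_le {d n : ℕ} [NeZero n] {Ω : Type*} [MeasurableSpace Ω]
    {P : Measure Ω} {x : Fin n → Ω → FlatTorus d n} {G : Ω → SimpleGraph (Fin n)}
    (h : IsRandomNNTree P x G) (S : Set (Fin n → FlatTorus d n)) :
    P {ω | (fun i => x i ω) ∈ S} ≤ (Measure.pi fun _ : Fin n => torusUniform d n) S := by
  have hm : ∀ i, AEMeasurable (x i) P := fun i => (h.law i).aemeasurable
  have h1 := Measure.le_map_apply (aemeasurable_pi_lambda (fun ω i => x i ω) hm) S
  have := h.indep.isProbabilityMeasure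
  rw [(iIndepFun_iff_map_fun_eq_pi_map hm).mp h.indep] at h1
  simp only [fun i => (h.law i).map_eq] at h1
  exact h1

theorem measureReal_graphMaxDegree_large_le {d n : ℕ} [NeZero n] (hd : 1 ≤ d)
    (hL : 8 * (d : ℝ) ≤ Real.log n) (hn : 16 ≤ n) :
    (Measure.pi fun _ : Fin n => torusUniform d n).real
      {x | ∃ G, IsNNTree x G ∧
        (3 + (d + 5) * (8 * d + 1) ^ d : ℝ) * Real.log n < graphMaxDegree G}
      ≤ Real.exp (-(Real.log n ^ 2 / 4)) := by
  classical
  have := isProbabilityMeasure_torusUniform (n := n) hd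
  set L := Real.log n with hLdef
  have hn0 : (0 : ℝ) < n := by exact_mod_cast NeZero.pos n
  have hn16 : (16 : ℝ) ≤ n := by exact_mod_cast hn
  have hd1 : (1 : ℝ) ≤ d := by exact_mod_cast hd
  have hL1 : 1 ≤ L := by linarith
  have hexp : Real.exp L = n := Real.exp_log hn0
  have hcrowd := measureReal_exists_crowded_le (n := n) hd (by omega) (⌈L⌉₊ + 1)
  refine (measureReal_mono ?_ (measure_ne_top _ _)).trans (hcrowd.trans ?_)
  · rintro x ⟨G, hG, hlarge⟩
    by_contra hx
    simp only [Set.mem_ofPred_eq, not_exists, not_le] at hx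
    -- Enough dyadic scales to reach from `1 / n` past the diameter: `2 ^ d ≥ d`, and `2 ^ (4 * L) ≥
    -- n ^ 2` because `4 * log 2 ≥ 2`.
    have hJ : d * torusSide d n ≤ 2 ^ (d + ⌈4 * L⌉₊) * (1 / (n : ℝ)) := by
      have h1 : (d : ℝ) ≤ 2 ^ d := by exact_mod_cast (Nat.lt_two_pow_self (n := d)).le
      have h2 : (n : ℝ) ^ 2 ≤ 2 ^ ⌈4 * L⌉₊ := by
        have h3 : Real.exp (2 * L) ≤ Real.exp (Real.log 2 * ⌈4 * L⌉₊) := by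
          refine Real.exp_le_exp.mpr ?_
          have h4 := Nat.le_ceil (4 * L)
          have h5 := Real.log_two_gt_d9
          nlinarith
        rw [Real.exp_mul (Real.log 2), Real.exp_log two_pos, Real.rpow_natCast] at h3
        calc (n : ℝ) ^ 2 = Real.exp (2 * L) := by
              rw [← hexp, ← Real.exp_nat_mul]; push_cast; rfl
          _ ≤ _ := h3
      rw [mul_one_div, le_div_iff₀ hn0, pow_add]
      calc d * torusSide d n * n ≤ d * n * n := by
            gcongr; exact torusSide_le hd
        _ = d * (n : ℝ) ^ 2 := by ring
        _ ≤ _ := by gcongr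
    have h1 := graphMaxDegree_le hG (r := 1 / (n : ℝ)) (by positivity) (m := ⌈L⌉₊)
      (fun v => by convert Nat.lt_succ_iff.mp (hx v)) hJ
    have h2 : (graphMaxDegree G : ℝ) ≤ 1 + ⌈L⌉₊ + (d + ⌈4 * L⌉₊) * (8 * d + 1) ^ d := by
      exact_mod_cast h1
    have h3 := (Nat.ceil_lt_add_one (by linarith : 0 ≤ L)).le
    have h4 := (Nat.ceil_lt_add_one (by linarith : 0 ≤ 4 * L)).le
    have h5 : (d + ⌈4 * L⌉₊ : ℝ) ≤ (d + 5) * L := by nlinarith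
    have h6 : (d + ⌈4 * L⌉₊ : ℝ) * (8 * d + 1) ^ d ≤ (d + 5) * L * (8 * d + 1) ^ d := by gcongr
    have h7 : (3 + (d + 5) * (8 * d + 1) ^ d : ℝ) * L
        = 3 * L + (d + 5) * L * (8 * d + 1) ^ d := by ring
    linarith
  -- This is `4 ≤ √n`. The union bound then has exponent at most `2 * d * L - L ^ 2 / 2`, and `8 * d
  -- ≤ L` absorbs the first term.
  · have h1 : (4 / n : ℝ) ≤ Real.exp (-(L / 2)) := by
      have e : Real.exp (-(L / 2)) = Real.exp (L / 2) / n := by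
        rw [← hexp, ← Real.exp_sub]; ring_nf
      rw [e]
      gcongr
      refine (sq_le_sq₀ (by norm_num) (Real.exp_pos _).le).mp ?_
      rw [← Real.exp_nat_mul]
      have e2 : ((2 : ℕ) : ℝ) * (L / 2) = L := by push_cast; ring
      rw [e2, hexp]
      linarith
    calc (n : ℝ) ^ (2 * d) * (4 / n) ^ (⌈L⌉₊ + 1)
        ≤ Real.exp L ^ (2 * d) * Real.exp (-(L / 2)) ^ (⌈L⌉₊ + 1) := by rw [hexp]; gcongr
      _ = Real.exp (2 * d * L + (⌈L⌉₊ + 1) * (-(L / 2))) := by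
          rw [← Real.exp_nat_mul, ← Real.exp_nat_mul, ← Real.exp_add]; push_cast; rfl
      _ ≤ _ := by
          refine Real.exp_le_exp.mpr ?_
          have := Nat.le_ceil L
          nlinarith

/-- The constants `c`, `C` and the rate `f` depend on `d` only. The probability bound is put on the
exceptional event, so that (`P` being an outer measure on arbitrary sets) it does not presuppose
that an arbitrary tie-breaking is measurable. -/
theorem mainTheorem2 (d : ℕ) (hd : 1 ≤ d) :
    ∃ c C : ℝ, 0 < c ∧ 0 < C ∧ ∃ f : ℕ → ℝ, Tendsto f atTop atTop ∧
      ∀ (n : ℕ) [NeZero n] {Ω : Type*} [MeasurableSpace Ω] (P : Measure Ω) [IsProbabilityMeasure P]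
        (x : Fin n → Ω → FlatTorus d n) (G : Ω → SimpleGraph (Fin n)),
        IsRandomNNTree P x G →
        P {ω | ¬ (c * Real.log n ≤ graphMaxDegree (G ω) ∧
            (graphMaxDegree (G ω) : ℝ) ≤ C * Real.log n)}
          ≤ ENNReal.ofReal ((n : ℝ) ^ (-f n)) := by
  set Q : ℝ := 16 * (4 * d + 4) ^ d with hQ
  have hQ1 : 1 < Q := by
    have : (1 : ℝ) ≤ (4 * d + 4) ^ d := by
      have : (0 : ℝ) ≤ d := by positivity
      exact one_le_pow₀ (by linarith)
    linarith
  have hlQ : 0 < Real.log Q := Real.log_pos hQ1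
  -- The term 96 makes `√n / 8 ≥ L ^ 2 / 4`, `64 * log Q` gives `K ≥ 4`, and `8 * d` serves the
  -- upper tail. Below this threshold the rate is 0 and the bound is trivial.
  set L₀ : ℝ := 96 + 64 * Real.log Q + 8 * d with hL₀
  have hlog : Tendsto (fun n : ℕ => Real.log n) atTop atTop :=
    Real.tendsto_log_atTop.comp tendsto_natCast_atTop_atTop
  refine ⟨1 / (32 * Real.log Q), 3 + (d + 5) * (8 * d + 1) ^ d, by positivity, by positivity,
    fun n => if L₀ ≤ Real.log n then Real.log n / 8 else 0, ?_, ?_⟩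
  · refine (hlog.atTop_div_const (by norm_num : (0 : ℝ) < 8)).congr' ?_
    filter_upwards [hlog.eventually_ge_atTop L₀] with n hn
    rw [if_pos hn]
  intro n _ Ω _ P _ x G hG
  by_cases hn : L₀ ≤ Real.log n
  swap
  · simpa [hn] using prob_le_one
  simp only [if_pos hn]
  have := isProbabilityMeasure_torusUniform (n := n) hd
  have hn0 : (0 : ℝ) < n := by exact_mod_cast NeZero.pos n
  have hd0 : (0 : ℝ) ≤ d := by positivity
  set L := Real.log n with hL
  have hexp : Real.exp L = n := Real.exp_log hn0
  have hn16 : 16 ≤ n := by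
    have := Real.log_le_sub_one_of_pos hn0
    have : (16 : ℝ) ≤ n := by linarith
    exact_mod_cast this
  set K : ℕ := ⌊L / (16 * Real.log Q)⌋₊ with hK
  have hL4 : 4 ≤ L / (16 * Real.log Q) := by
    rw [le_div_iff₀ (by positivity)]
    linarith
  have hK4 : 4 ≤ K := Nat.le_floor (by exact_mod_cast hL4)
  have hKn : Q ^ (16 * K) ≤ n := by
    have h1 : (K : ℝ) ≤ L / (16 * Real.log Q) := Nat.floor_le (by linarith)
    rw [le_div_iff₀ (by positivity)] at h1
    calc Q ^ (16 * K) = Real.exp (K * (16 * Real.log Q)) := by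
          rw [← Real.exp_log (by linarith : 0 < Q), ← Real.exp_nat_mul, Real.log_exp]
          push_cast
          ring_nf
      _ ≤ Real.exp L := Real.exp_le_exp.mpr h1
      _ = n := hexp
  have hlow := measureReal_graphMaxDegree_small_le (n := n) hd (by omega : 0 < K) hKn
  have hhigh := measureReal_graphMaxDegree_large_le (n := n) hd (by linarith) hn16
  set S₁ := {x : Fin n → FlatTorus d n | ∃ G, IsNNTree x G ∧ graphMaxDegree G + 1 < K}
  set S₂ := {x : Fin n → FlatTorus d n | ∃ G, IsNNTree x G ∧
        (3 + (d + 5) * (8 * d + 1) ^ d : ℝ) * Real.log n < graphMaxDegree G}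
  have hsub : {ω | ¬ (1 / (32 * Real.log Q) * L ≤ graphMaxDegree (G ω) ∧
      (graphMaxDegree (G ω) : ℝ) ≤ (3 + (d + 5) * (8 * d + 1) ^ d) * L)}
      ⊆ {ω | (fun i => x i ω) ∈ S₁ ∪ S₂} := by
    intro ω hω
    rcases not_and_or.mp hω with h | h
    · refine Or.inl ⟨G ω, hG.tree ω, ?_⟩
      by_contra hle
      have h1 : (K : ℝ) ≤ graphMaxDegree (G ω) + 1 := by exact_mod_cast not_lt.mp hle
      -- For `y = L / (16 * log Q) ≥ 4` the degree is at least `K - 1 > y - 2 ≥ y / 2`; halving `y`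
      -- in the constant `c` pays for the rounding and the lost block.
      have h2 : L / (16 * Real.log Q) < K + 1 := Nat.lt_floor_add_one _
      have h3 : 1 / (32 * Real.log Q) * L = L / (16 * Real.log Q) / 2 := by
        field_simp; ring
      rw [h3] at h
      linarith
    · exact Or.inr ⟨G ω, hG.tree ω, not_le.mp h⟩
  refine (measure_mono hsub).trans ((hG.measure_preimage_le _).trans ?_)
  rw [← ofReal_measureReal (measure_ne_top _ _)]
  refine ENNReal.ofReal_le_ofReal ((measureReal_union_le _ _).trans ?_)
  have hsqrt : Real.exp (-(Real.sqrt n / 8)) ≤ Real.exp (-(L ^ 2 / 4)) := by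
    refine Real.exp_le_exp.mpr (neg_le_neg ?_)
    have h1 : Real.sqrt n = Real.exp (L / 2) := by
      rw [Real.exp_half, hexp]
    have h2 := Real.pow_div_factorial_le_exp (L / 2) (by linarith) 3
    have h3 : (Nat.factorial 3 : ℝ) = 6 := by norm_num [Nat.factorial]
    rw [h3] at h2
    rw [h1]
    have h4 : 96 * L ^ 2 ≤ L * L ^ 2 := by
      gcongr
      linarith
    nlinarith
  have hpow : (n : ℝ) ^ (-(L / 8)) = Real.exp (-(L ^ 2 / 8)) := by
    rw [Real.rpow_def_of_pos hn0, ← hL]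
    ring_nf
  have hdouble : 2 * Real.exp (-(L ^ 2 / 4)) ≤ Real.exp (-(L ^ 2 / 8)) := by
    have h1 : 2 ≤ Real.exp (L ^ 2 / 8) := by
      have h2 := Real.add_one_le_exp (L ^ 2 / 8)
      nlinarith
    calc 2 * Real.exp (-(L ^ 2 / 4)) ≤ Real.exp (L ^ 2 / 8) * Real.exp (-(L ^ 2 / 4)) := by gcongr
      _ = Real.exp (-(L ^ 2 / 8)) := by rw [← Real.exp_add]; ring_nf
  rw [hpow]
  linarith
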